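/- **Setting.** A \emph{frame} is a complete lattice in which finite meets distribute over arbitrary joins; frame homomorphisms preserve finite meets and arbitrary joins. A \emph{Frith frame} is a pair $(L,S)$ with $L$ a frame and $S\subseteq L$ a bounded sublattice such that every element of $L$ is a join of elements of $S$; a morphism $(L,S)\to(M,T)$ is a frame homomorphism $h:L\to M$ with $h[S]\subseteq T$. A \emph{biframe} is a triple $\mathcal L=(L,L_+,L_-)$ with $L$ a frame and $L_+,L_-$ subframes of $L$ such that every element of $L$ is a join of finite meets of elements of $L_+\cup L_-$; a morphism $(L,L_+,L_-)\to(M,M_+,M_-)$ is a frame homomorphism $h:L\to M$ with $h[L_+]\subseteq M_+$ and $h[L_-]\subseteq M_-$. An element $a\in L_+$ (resp. $a\in L_-$) is \emph{positive} (resp. \emph{negative}) \emph{bicomplemented} if it has a complement in $L$ that lies in $L_-$ (resp. $L_+$). The biframe $\mathcal L$ is \emph{compact} if the top element of $L$ is compact, and \emph{zero-dimensional} if every element of $L_+$ (resp. $L_-$) is a join of positive (resp. negative) bicomplemented elements. For a frame $L$ let $\mathcal C L$ be the frame of frame congruences on $L$, ordered by inclusion, and for $a\in L$ put $\nabla_a=\{(x,y):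 a\vee x=a\vee y\}$ and $\Delta_a=\{(x,y): a\wedge x=a\wedge y\}$. For a Frith frame $(L,S)$ let $\nabla L$ and $\Delta S$ be the subframes of $\mathcal C L$ generated by $\{\nabla_a: a\in L\}$ and $\{\Delta_s: s\in S\}$, and let $\mathcal C_S L$ be the subframe generated by $\nabla L\cup\Delta S$. The meet $\bigwedge P$ of a subset $P\subseteq L$ is \emph{strongly exact} if $\bigvee_{s\in P}\Delta_s=\Delta_a$ for some $a\in L$; and $(L,S)$ is \emph{strongly exact} if $\bigwedge P\in S$ whenever $P\subseteq S$ and $\bigwedge P$ is strongly exact. Let $\mathsf{Sk}$ be the functor from Frith frames to biframes given on objects by $(L,S)\mapsto(\mathcal C_S L,\nabla L,\Delta S)$, and sending a morphism $h:(L,S)\to(M,T)$ to the frame homomorphism $\overline h:\mathcal C_S L\to\mathcal C_T M$ that takes $\theta$ to the congruence generated by $\{(h(x),h(y)):(x,y)\in\theta\}$, so that $\overline h(\nabla_a)=\nabla_{h(a)}$ for $a\in L$ and $\overline h(\Delta_s)=\Delta_{h(s)}$ for $s\in S$. Let $\mathsf B_+$ be the functor from biframes to Frith frames sending $\mathcal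 L$ to $(\langle B_+(\mathcal L)\rangle, B_+(\mathcal L))$, where $B_+(\mathcal L)$ is the lattice of positive bicomplemented elements of $\mathcal L$ and $\langle B_+(\mathcal L)\rangle$ is the subframe it generates, and acting on morphisms by restriction and co-restriction. **Statement.** There is an adjunction $\mathsf{Sk}\dashv\mathsf B_+$ with the following properties. 1. Its unit at a Frith frame $(L,S)$ is the map $a\mapsto\nabla_a$. 2. It is idempotent: the counit at $\mathsf{Sk}(L,S)$ is an isomorphism for every Frith frame $(L,S)$, and the unit at $\mathsf B_+(\mathcal L)$ is an isomorphism for every biframe $\mathcal L$. 3. The unit at a Frith frame $(L,S)$ is an isomorphism if and only if $(L,S)$ is strongly exact. 4. If a biframe $\mathcal L$ is compact and zero-dimensional, then the counit at $\mathcal L$ is an isomorphism. 5. Every biframe $\mathsf{Sk}(L,S)$ is zero-dimensional and every Frith frame $\mathsf B_+(\mathcal L)$ is strongly exact; and the restriction of $\mathsf{Sk}$ to a functor from the full subcategory of strongly exact Frith frames to the full subcategory of zero-dimensional biframes is full and faithful and has a right adjoint, namely (up to natural isomorphism) the restriction of $\mathsf B_+$. Thus strongly exact Frith frames form a full coreflective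 subcategory of the category of zero-dimensional biframes. -/

import Mathlib

open CategoryTheory

universe u

/-! ### Subframes -/

/-- A subframe: a subset closed under finite meets and arbitrary joins. -/
structure Subframe (L : Type u) [Order.Frame L] where
  carrier : Set L
  top_mem' : ⊤ ∈ carrier
  inf_mem' : ∀ {a b : L}, a ∈ carrier → b ∈ carrier → a ⊓ b ∈ carrier
  sSup_mem' : ∀ A : Set L, A ⊆ carrier → sSup A ∈ carrier

namespace Subframe

variable {L : Type u} [Order.Frame L]

instance : SetLike (Subframe L) L where
  coe T := T.carrier
  coe_injective T U h := by
    cases T; cases U; congr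

theorem top_mem (T : Subframe L) : ⊤ ∈ T := T.top_mem'

theorem inf_mem (T : Subframe L) {a b : L} (ha : a ∈ T) (hb : b ∈ T) : a ⊓ b ∈ T :=
  T.inf_mem' ha hb

theorem sSup_mem (T : Subframe L) {A : Set L} (hA : ∀ a ∈ A, a ∈ T) : sSup A ∈ T :=
  T.sSup_mem' A hA

theorem bot_mem (T : Subframe L) : ⊥ ∈ T := by
  rw [← sSup_empty]; exact T.sSup_mem (by simp)

theorem sup_mem (T : Subframe L) {a b : L} (ha : a ∈ T) (hb : b ∈ T) : a ⊔ b ∈ T := by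
  rw [← sSup_pair]
  refine T.sSup_mem ?_
  rintro x (rfl | rfl)
  · exact ha
  · exact hb

/-- A subframe is a complete lattice for the induced order; joins and finite meets are those of the
ambient frame. -/
instance instCompleteLattice (T : Subframe L) : CompleteLattice T where
  sup x y := ⟨x.1 ⊔ y.1, T.sup_mem x.2 y.2⟩
  le_sup_left x y := show x.1 ≤ x.1 ⊔ y.1 from le_sup_left
  le_sup_right x y := show y.1 ≤ x.1 ⊔ y.1 from le_sup_right
  sup_le x y z h₁ h₂ := show x.1 ⊔ y.1 ≤ z.1 from sup_le h₁ h₂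
  inf x y := ⟨x.1 ⊓ y.1, T.inf_mem x.2 y.2⟩
  inf_le_left x y := show x.1 ⊓ y.1 ≤ x.1 from inf_le_left
  inf_le_right x y := show x.1 ⊓ y.1 ≤ y.1 from inf_le_right
  le_inf x y z h₁ h₂ := show x.1 ≤ y.1 ⊓ z.1 from le_inf h₁ h₂
  sSup A := ⟨sSup (Subtype.val '' A), T.sSup_mem (by rintro _ ⟨x, _, rfl⟩; exact x.2)⟩
  isLUB_sSup A := by
    constructor
    · intro x hx
      exact show x.1 ≤ sSup (Subtype.val '' A) from le_sSup ⟨x, hx, rfl⟩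
    · intro y hy
      refine show sSup (Subtype.val '' A) ≤ y.1 from sSup_le ?_
      rintro _ ⟨x, hx, rfl⟩
      exact hy hx
  sInf A := ⟨sSup {y | y ∈ T ∧ ∀ x ∈ A, y ≤ x.1}, T.sSup_mem (fun _ h => h.1)⟩
  isGLB_sInf A := by
    constructor
    · intro x hx
      exact show sSup {y | y ∈ T ∧ ∀ x ∈ A, y ≤ x.1} ≤ x.1 from sSup_le (fun y hy => hy.2 x hx)
    · intro y hy
      exact show y.1 ≤ sSup {y | y ∈ T ∧ ∀ x ∈ A, y ≤ x.1} from le_sSup ⟨y.2, fun x hx => hy hx⟩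
  top := ⟨⊤, T.top_mem⟩
  le_top x := show x.1 ≤ ⊤ from le_top
  bot := ⟨⊥, T.bot_mem⟩
  bot_le x := show ⊥ ≤ x.1 from bot_le

variable (T : Subframe L)

@[simp] theorem coe_top : ((⊤ : T) : L) = ⊤ := rfl
@[simp] theorem coe_bot : ((⊥ : T) : L) = ⊥ := rfl
@[simp] theorem coe_inf (x y : T) : ((x ⊓ y : T) : L) = x.1 ⊓ y.1 := rfl
@[simp] theorem coe_sup (x y : T) : ((x ⊔ y : T) : L) = x.1 ⊔ y.1 := rfl
@[simp] theorem coe_sSup (A : Set T) : ((sSup A : T) : L) = sSup (Subtype.val '' A) := rfl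

/-- A subframe is a frame. -/
instance instFrame : Order.Frame T := .ofMinimalAxioms
  { inf_sSup_le_iSup_inf := by
      intro a A
      show a.1 ⊓ sSup (Subtype.val '' A) ≤ (⨆ b ∈ A, a ⊓ b : T).1
      rw [inf_sSup_eq]
      refine iSup₂_le ?_
      rintro _ ⟨b, hb, rfl⟩
      exact (le_iSup₂ (f := fun (b : T) (_ : b ∈ A) => a ⊓ b) b hb : a ⊓ b ≤ _) }

/-- The subframe generated by a subset. -/
def closure (X : Set L) : Subframe L where
  carrier := {x | ∀ T : Subframe L, X ⊆ T → x ∈ T}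
  top_mem' T _ := T.top_mem
  inf_mem' ha hb T hT := T.inf_mem (ha T hT) (hb T hT)
  sSup_mem' _ hA T hT := T.sSup_mem (fun _ ha => hA ha T hT)

theorem subset_closure (X : Set L) : X ⊆ closure X := fun _ hx _ hT => hT hx

theorem closure_le {X : Set L} {T : Subframe L} (h : X ⊆ T) : ∀ x ∈ closure X, x ∈ T :=
  fun _ hx => hx T h

/-- The part of a subframe `U` that lies in a subframe `T`, as a subframe of `T`. -/
def within (T U : Subframe L) : Subframe T where
  carrier := {x | x.1 ∈ U}
  top_mem' := U.top_mem
  inf_mem' ha hb := U.inf_mem ha hb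
  sSup_mem' A hA := U.sSup_mem (by rintro _ ⟨x, hx, rfl⟩; exact hA hx)

theorem mem_within {T U : Subframe L} {x : T} : x ∈ within T U ↔ x.1 ∈ U := Iff.rfl

/-- The image in `L` of a subframe of a subframe of `L`. -/
def lift {T : Subframe L} (U : Subframe T) : Subframe L where
  carrier := {x | ∃ h : x ∈ T, (⟨x, h⟩ : T) ∈ U}
  top_mem' := ⟨T.top_mem, U.top_mem⟩
  inf_mem' := fun ⟨h₁, h₁'⟩ ⟨h₂, h₂'⟩ => ⟨T.inf_mem h₁ h₂, U.inf_mem h₁' h₂'⟩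
  sSup_mem' A hA := by
    have hmem : sSup A ∈ T := T.sSup_mem fun _ ha => (hA ha).1
    have hset : A = Subtype.val '' {x : T | x.1 ∈ A} := by
      refine Set.ext fun x => ⟨fun hx => ⟨⟨x, (hA hx).1⟩, hx, rfl⟩, ?_⟩
      rintro ⟨y, hy, rfl⟩
      exact hy
    have heq : (⟨sSup A, hmem⟩ : T) = sSup {x : T | x.1 ∈ A} :=
      Subtype.ext ((congrArg sSup hset).trans (coe_sSup T _).symm)
    refine ⟨hmem, ?_⟩
    rw [heq]
    exact U.sSup_mem fun _ ha => (hA ha).2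

/-- Joins of finite meets of elements of `P`. -/
def joinsOfMeets (P : Set L) : Subframe L where
  carrier := {x | ∃ A : Set L, (∀ y ∈ A, ∃ F : Finset L, (↑F : Set L) ⊆ P ∧ F.inf id = y) ∧
    sSup A = x}
  top_mem' := ⟨{⊤}, by rintro _ rfl; exact ⟨∅, by simp, rfl⟩, by simp⟩
  inf_mem' := by
    classical
    rintro _ _ ⟨A, hA, rfl⟩ ⟨B, hB, rfl⟩
    refine ⟨{z | ∃ a ∈ A, ∃ b ∈ B, a ⊓ b = z}, ?_, ?_⟩
    · rintro _ ⟨a, ha, b, hb, rfl⟩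
      obtain ⟨F, hF, rfl⟩ := hA a ha
      obtain ⟨G, hG, rfl⟩ := hB b hb
      exact ⟨F ∪ G, by simp [hF, hG], Finset.inf_union⟩
    · rw [sSup_inf_sSup]
      apply le_antisymm
      · refine sSup_le ?_
        rintro _ ⟨a, ha, b, hb, rfl⟩
        exact le_iSup₂ (f := fun (p : L × L) (_ : p ∈ A ×ˢ B) => p.1 ⊓ p.2) (a, b) ⟨ha, hb⟩
      · refine iSup₂_le ?_
        rintro ⟨a, b⟩ ⟨ha, hb⟩
        exact le_sSup ⟨a, ha, b, hb, rfl⟩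
  sSup_mem' := by
    intro 𝒜 h𝒜
    refine ⟨{y | (∃ F : Finset L, (↑F : Set L) ⊆ P ∧ F.inf id = y) ∧ y ≤ sSup 𝒜},
      fun y hy => hy.1, ?_⟩
    apply le_antisymm (sSup_le fun y hy => hy.2)
    refine sSup_le fun x hx => ?_
    obtain ⟨A, hA, rfl⟩ := h𝒜 hx
    exact sSup_le fun y hy => le_sSup ⟨hA y hy, (le_sSup hy).trans (le_sSup hx)⟩

theorem subset_joinsOfMeets (P : Set L) : P ⊆ joinsOfMeets P := fun x hx => by
  refine ⟨{x}, fun y hy => ⟨({x} : Finset L), by simpa using hx, ?_⟩, by simp⟩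
  rw [Set.mem_singleton_iff] at hy
  simp [hy]

end Subframe

/-- Restriction and co-restriction of a frame homomorphism to subframes. -/
def FrameHom.restrictSubframe {L M : Type u} [Order.Frame L] [Order.Frame M] (h : FrameHom L M)
    (T : Subframe L) (U : Subframe M) (hTU : ∀ x ∈ T, h x ∈ U) : FrameHom T U where
  toFun x := ⟨h x.1, hTU x.1 x.2⟩
  map_top' := Subtype.ext (map_top h)
  map_inf' x y := Subtype.ext (map_inf h x.1 y.1)
  map_sSup' A := Subtype.ext (by
    show h (sSup (Subtype.val '' A)) = sSup (Subtype.val '' _)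
    rw [map_sSup]
    congr 1
    simp [Set.image_image])

/-- The preimage of a subframe under a frame homomorphism. -/
def Subframe.comap {L M : Type u} [Order.Frame L] [Order.Frame M] (h : FrameHom L M)
    (U : Subframe M) : Subframe L where
  carrier := {x | h x ∈ U}
  top_mem' := by simpa using U.top_mem
  inf_mem' ha hb := by
    show h _ ∈ U
    rw [map_inf]; exact U.inf_mem ha hb
  sSup_mem' A hA := by
    show h _ ∈ U
    rw [map_sSup]
    refine U.sSup_mem ?_
    rintro _ ⟨x, hx, rfl⟩
    exact hA hx

/-! ### The frame of frame congruences -/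

/-- A frame congruence: an equivalence relation compatible with finite meets and arbitrary joins. -/
@[ext]
structure FrameCon (L : Type u) [Order.Frame L] where
  r : L → L → Prop
  iseqv : Equivalence r
  inf' : ∀ {a b c d : L}, r a b → r c d → r (a ⊓ c) (b ⊓ d)
  iSup' : ∀ {ι : Type u} (f g : ι → L), (∀ i, r (f i) (g i)) → r (⨆ i, f i) (⨆ i, g i)

namespace FrameCon

variable {L M N : Type u} [Order.Frame L] [Order.Frame M] [Order.Frame N]

theorem sup' (θ : FrameCon L) {a b c d : L} (h₁ : θ.r a b) (h₂ : θ.r c d) :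
    θ.r (a ⊔ c) (b ⊔ d) := by
  have := θ.iSup' (fun i : ULift.{u} Bool => bif i.down then a else c)
    (fun i : ULift.{u} Bool => bif i.down then b else d)
    (by rintro ⟨_ | _⟩ <;> assumption)
  simpa [iSup_ulift, iSup_bool_eq] using this

/-- Congruences are ordered by inclusion. -/
instance : PartialOrder (FrameCon L) where
  le θ φ := ∀ x y, θ.r x y → φ.r x y
  le_refl _ _ _ h := h
  le_trans _ _ _ h₁ h₂ x y h := h₂ x y (h₁ x y h)
  le_antisymm θ φ h₁ h₂ := by
    ext x y
    exact ⟨h₁ x y, h₂ x y⟩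

theorem le_def {θ φ : FrameCon L} : θ ≤ φ ↔ ∀ x y, θ.r x y → φ.r x y := Iff.rfl

instance : InfSet (FrameCon L) where
  sInf A :=
    { r := fun x y => ∀ θ ∈ A, θ.r x y
      iseqv := ⟨fun x θ _ => θ.iseqv.refl x, fun h θ hθ => θ.iseqv.symm (h θ hθ),
        fun h₁ h₂ θ hθ => θ.iseqv.trans (h₁ θ hθ) (h₂ θ hθ)⟩
      inf' := fun h₁ h₂ θ hθ => θ.inf' (h₁ θ hθ) (h₂ θ hθ)
      iSup' := fun f g h θ hθ => θ.iSup' f g fun i => h i θ hθ }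

instance : Min (FrameCon L) where
  min θ φ :=
    { r := fun x y => θ.r x y ∧ φ.r x y
      iseqv := ⟨fun x => ⟨θ.iseqv.refl x, φ.iseqv.refl x⟩,
        fun h => ⟨θ.iseqv.symm h.1, φ.iseqv.symm h.2⟩,
        fun h₁ h₂ => ⟨θ.iseqv.trans h₁.1 h₂.1, φ.iseqv.trans h₁.2 h₂.2⟩⟩
      inf' := fun h₁ h₂ => ⟨θ.inf' h₁.1 h₂.1, φ.inf' h₁.2 h₂.2⟩
      iSup' := fun f g h => ⟨θ.iSup' f g fun i => (h i).1, φ.iSup' f g fun i => (h i).2⟩ }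

/-- Meets of congruences are intersections; the join of a family is the congruence it generates. -/
instance : CompleteLattice (FrameCon L) where
  __ := completeLatticeOfInf (FrameCon L) (by
    intro A
    exact ⟨fun θ hθ x y h => h θ hθ, fun φ hφ x y h θ hθ => hφ hθ x y h⟩)
  inf := min
  inf_le_left _ _ _ _ h := h.1
  inf_le_right _ _ _ _ h := h.2
  le_inf _ _ _ h₁ h₂ x y h := ⟨h₁ x y h, h₂ x y h⟩

theorem inf_r {θ φ : FrameCon L} {x y : L} : (θ ⊓ φ).r x y ↔ θ.r x y ∧ φ.r x y := Iff.rfl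

/-- The largest element of the congruence class of `x`. -/
def sat (θ : FrameCon L) (x : L) : L := sSup {y | θ.r y x}

theorem r_sat (θ : FrameCon L) (x : L) : θ.r (θ.sat x) x := by
  have h := θ.iSup' (fun i : {y | θ.r y x} => (i : L)) (fun _ => x) (fun i => i.2)
  have : Nonempty {y | θ.r y x} := ⟨⟨x, θ.iseqv.refl x⟩⟩
  rw [iSup_const] at h
  rwa [sat, sSup_eq_iSup']

theorem le_sat (θ : FrameCon L) {x y : L} (h : θ.r y x) : y ≤ θ.sat x := le_sSup h

theorem sat_eq_iff (θ : FrameCon L) {x y : L} : θ.sat x = θ.sat y ↔ θ.r x y := by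
  constructor
  · intro h
    exact θ.iseqv.trans (θ.iseqv.symm (θ.r_sat x)) (h ▸ θ.r_sat y)
  · intro h
    exact le_antisymm (θ.le_sat (θ.iseqv.trans (θ.r_sat x) h))
      (θ.le_sat (θ.iseqv.trans (θ.r_sat y) (θ.iseqv.symm h)))

theorem sat_mono (θ : FrameCon L) {x y : L} (h : x ≤ y) : θ.sat x ≤ θ.sat y := by
  have := θ.sup' (θ.r_sat x) (θ.iseqv.refl y)
  rw [sup_eq_right.2 h] at this
  exact le_sup_left.trans (θ.le_sat this)

/-- The nucleus of a congruence. -/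
def toNucleus (θ : FrameCon L) : Nucleus L where
  toFun := θ.sat
  map_inf' x y := le_antisymm
    (le_inf (θ.sat_mono inf_le_left) (θ.sat_mono inf_le_right))
    (θ.le_sat (θ.inf' (θ.r_sat x) (θ.r_sat y)))
  idempotent' x := (θ.sat_eq_iff.2 (θ.r_sat x)).le
  le_apply' x := θ.le_sat (θ.iseqv.refl x)

/-- The kernel congruence of a nucleus. -/
def ofNucleus (n : Nucleus L) : FrameCon L where
  r x y := n x = n y
  iseqv := ⟨fun _ => rfl, fun h => h.symm, fun h₁ h₂ => h₁.trans h₂⟩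
  inf' h₁ h₂ := by rw [n.map_inf, n.map_inf, h₁, h₂]
  iSup' {ι} f g h := by
    have key : ∀ f g : ι → L, (∀ i, n (f i) = n (g i)) → n (⨆ i, f i) ≤ n (⨆ i, g i) := by
      intro f g h
      rw [← n.idempotent (⨆ i, g i)]
      refine n.monotone (iSup_le fun i => ?_)
      exact n.le_apply.trans ((h i).le.trans (n.monotone (le_iSup g i)))
    exact le_antisymm (key f g h) (key g f fun i => (h i).symm)

/-- Congruences correspond to nuclei. -/
def nucleusIso : FrameCon L ≃o Nucleus L where
  toFun := toNucleus
  invFun := ofNucleus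
  left_inv θ := by
    ext x y
    exact θ.sat_eq_iff
  right_inv n := by
    ext x
    apply le_antisymm
    · refine sSup_le ?_
      intro y hy
      exact n.le_apply.trans (le_of_eq hy)
    · exact le_sSup (n.idempotent x)
  map_rel_iff' := by
    intro θ φ
    constructor
    · intro h x y hxy
      rw [← φ.sat_eq_iff]
      have key : ∀ x y, θ.r x y → φ.sat x ≤ φ.sat y := by
        intro x y hxy
        have h1 : x ≤ φ.sat y := (θ.le_sat hxy).trans (h y)
        exact (φ.sat_mono h1).trans (φ.sat_eq_iff.2 (φ.r_sat y)).le
      exact le_antisymm (key x y hxy) (key y x (θ.iseqv.symm hxy))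
    · intro h x
      exact sSup_le fun y hy => φ.le_sat (h _ _ hy)

/-- The congruences of a frame form a frame. -/
instance : Order.Frame (FrameCon L) := .ofMinimalAxioms
  { inf_sSup_le_iSup_inf := by
      intro a A
      rw [← nucleusIso.le_iff_le]
      simp only [map_inf, map_sSup, map_iSup, sSup_image, inf_iSup_eq]
      exact le_rfl }

/-- The closed congruence `∇ₐ = {(x, y) | a ∨ x = a ∨ y}`. -/
def nabla (a : L) : FrameCon L where
  r x y := a ⊔ x = a ⊔ y
  iseqv := ⟨fun _ => rfl, fun h => h.symm, fun h₁ h₂ => h₁.trans h₂⟩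
  inf' h₁ h₂ := by rw [sup_inf_left, sup_inf_left, h₁, h₂]
  iSup' {ι} f g h := by
    have key : ∀ f g : ι → L, (∀ i, a ⊔ f i = a ⊔ g i) → a ⊔ ⨆ i, f i ≤ a ⊔ ⨆ i, g i := by
      intro f g h
      refine sup_le le_sup_left (iSup_le fun i => ?_)
      calc f i ≤ a ⊔ f i := le_sup_right
        _ = a ⊔ g i := h i
        _ ≤ _ := sup_le_sup_left (le_iSup g i) a
    exact le_antisymm (key f g h) (key g f fun i => (h i).symm)

/-- The open congruence `Δₐ = {(x, y) | a ∧ x = a ∧ y}`. -/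
def delta (a : L) : FrameCon L where
  r x y := a ⊓ x = a ⊓ y
  iseqv := ⟨fun _ => rfl, fun h => h.symm, fun h₁ h₂ => h₁.trans h₂⟩
  inf' h₁ h₂ := by rw [inf_inf_distrib_left, h₁, h₂, ← inf_inf_distrib_left]
  iSup' f g h := by simp only [inf_iSup_eq, h]

theorem nabla_le {θ : FrameCon L} {a : L} : nabla a ≤ θ ↔ θ.r a ⊥ := by
  constructor
  · intro h
    exact h _ _ (by simp [nabla])
  · intro h x y (hxy : a ⊔ x = a ⊔ y)
    have h1 := θ.sup' h (θ.iseqv.refl x)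
    have h2 := θ.sup' h (θ.iseqv.refl y)
    rw [bot_sup_eq] at h1 h2
    exact θ.iseqv.trans (θ.iseqv.symm h1) (hxy ▸ h2)

theorem delta_le {θ : FrameCon L} {a : L} : delta a ≤ θ ↔ θ.r a ⊤ := by
  constructor
  · intro h
    exact h _ _ (by simp [delta])
  · intro h x y (hxy : a ⊓ x = a ⊓ y)
    have h1 := θ.inf' h (θ.iseqv.refl x)
    have h2 := θ.inf' h (θ.iseqv.refl y)
    rw [top_inf_eq] at h1 h2
    exact θ.iseqv.trans (θ.iseqv.symm h1) (hxy ▸ h2)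

theorem nabla_inf_delta_le {θ : FrameCon L} {a b : L} :
    nabla a ⊓ delta b ≤ θ ↔ θ.r (a ⊔ b) b := by
  constructor
  · intro h
    exact h _ _ ⟨by simp [nabla], by simp [delta]⟩
  · rintro h x y ⟨hx : a ⊔ x = a ⊔ y, hy : b ⊓ x = b ⊓ y⟩
    have key : ∀ x y, a ⊔ x = a ⊔ y → b ⊓ x = b ⊓ y → θ.r x (x ⊓ y) := by
      intro x y hx hy
      have h1 : x ⊓ y ⊔ x ⊓ (a ⊔ b) = x := by
        rw [← inf_sup_left, inf_eq_left]
        calc x ≤ a ⊔ x := le_sup_right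
          _ = a ⊔ y := hx
          _ ≤ _ := sup_le (le_sup_left.trans le_sup_right) le_sup_left
      have h2 : x ⊓ y ⊔ x ⊓ b = x ⊓ y := by
        rw [sup_eq_left]
        exact le_inf inf_le_left ((inf_comm x b).trans hy ▸ inf_le_right)
      have h3 := θ.sup' (θ.iseqv.refl (x ⊓ y)) (θ.inf' (θ.iseqv.refl x) h)
      rwa [h1, h2] at h3
    exact θ.iseqv.trans (key x y hx hy)
      (θ.iseqv.symm (inf_comm x y ▸ key y x hx.symm hy.symm))

theorem nabla_inf (a b : L) : nabla (a ⊓ b) = nabla a ⊓ nabla b := by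
  apply le_antisymm
  · rw [nabla_le]
    exact ⟨by simp [nabla], by simp [nabla]⟩
  · rintro x y ⟨h₁ : a ⊔ x = a ⊔ y, h₂ : b ⊔ x = b ⊔ y⟩
    show a ⊓ b ⊔ x = a ⊓ b ⊔ y
    rw [sup_inf_right, sup_inf_right, h₁, h₂]

theorem delta_sup (a b : L) : delta (a ⊔ b) = delta a ⊓ delta b := by
  apply le_antisymm
  · rw [delta_le]
    exact ⟨by simp [delta], by simp [delta]⟩
  · rintro x y ⟨h₁ : a ⊓ x = a ⊓ y, h₂ : b ⊓ x = b ⊓ y⟩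
    show (a ⊔ b) ⊓ x = (a ⊔ b) ⊓ y
    rw [inf_sup_right, inf_sup_right, h₁, h₂]

/-- The inverse image of a congruence under a frame homomorphism. -/
def comap (h : FrameHom L M) (φ : FrameCon M) : FrameCon L where
  r x y := φ.r (h x) (h y)
  iseqv := ⟨fun _ => φ.iseqv.refl _, fun h => φ.iseqv.symm h, fun h₁ h₂ => φ.iseqv.trans h₁ h₂⟩
  inf' h₁ h₂ := by rw [InfHomClass.map_inf, InfHomClass.map_inf]; exact φ.inf' h₁ h₂
  iSup' f g hfg := by rw [map_iSup, map_iSup]; exact φ.iSup' _ _ hfg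

/-- The congruence generated by the image of a congruence under a frame homomorphism. -/
def map (h : FrameHom L M) (θ : FrameCon L) : FrameCon M :=
  sInf {φ | ∀ x y, θ.r x y → φ.r (h x) (h y)}

theorem gc (h : FrameHom L M) : GaloisConnection (map h) (comap h) := by
  intro θ φ
  constructor
  · intro hle x y hxy
    exact hle _ _ fun ψ hψ => hψ x y hxy
  · intro hle x y hxy
    exact hxy φ hle

theorem map_nabla (h : FrameHom L M) (a : L) : map h (nabla a) = nabla (h a) := by
  apply le_antisymm
  · rw [gc h, nabla_le]
    simp [comap, nabla]
  · rw [nabla_le, ← map_bot h]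
    exact (gc h).le_u_l (nabla a) a ⊥ (by simp [nabla])

theorem map_delta (h : FrameHom L M) (a : L) : map h (delta a) = delta (h a) := by
  apply le_antisymm
  · rw [gc h, delta_le]
    simp [comap, delta]
  · rw [delta_le, ← map_top h]
    exact (gc h).le_u_l (delta a) a ⊤ (by simp [delta])

theorem map_nabla_inf_delta (h : FrameHom L M) (a b : L) :
    map h (nabla a ⊓ delta b) = nabla (h a) ⊓ delta (h b) := by
  apply le_antisymm
  · refine le_inf ?_ ?_
    · rw [← map_nabla]; exact (gc h).monotone_l inf_le_left
    · rw [← map_delta]; exact (gc h).monotone_l inf_le_right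
  · rw [nabla_inf_delta_le, ← SupHomClass.map_sup h]
    exact (gc h).le_u_l (nabla a ⊓ delta b) (a ⊔ b) b (nabla_inf_delta_le.1 le_rfl)

theorem eq_iSup (θ : FrameCon L) :
    θ = ⨆ p : {p : L × L // θ.r p.1 p.2}, nabla p.1.1 ⊓ delta p.1.2 := by
  apply le_antisymm
  · intro x y hxy
    set ψ := ⨆ p : {p : L × L // θ.r p.1 p.2}, nabla p.1.1 ⊓ delta p.1.2
    have h1 : ψ.r (x ⊔ y) y := nabla_inf_delta_le.1
      (le_iSup (fun p : {p : L × L // θ.r p.1 p.2} => nabla p.1.1 ⊓ delta p.1.2) ⟨(x, y), hxy⟩)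
    have h2 : ψ.r (y ⊔ x) x := nabla_inf_delta_le.1
      (le_iSup (fun p : {p : L × L // θ.r p.1 p.2} => nabla p.1.1 ⊓ delta p.1.2)
        ⟨(y, x), θ.iseqv.symm hxy⟩)
    rw [sup_comm] at h2
    exact ψ.iseqv.trans (ψ.iseqv.symm h2) h1
  · refine iSup_le ?_
    rintro ⟨⟨a, b⟩, hab⟩
    rw [nabla_inf_delta_le]
    simpa using θ.sup' hab (θ.iseqv.refl b)

theorem map_inf (h : FrameHom L M) (θ φ : FrameCon L) : map h (θ ⊓ φ) = map h θ ⊓ map h φ := by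
  apply le_antisymm
  · exact le_inf ((gc h).monotone_l inf_le_left) ((gc h).monotone_l inf_le_right)
  · conv_lhs => rw [eq_iSup θ, eq_iSup φ, (gc h).l_iSup, (gc h).l_iSup]
    simp only [iSup_inf_eq, inf_iSup_eq]
    refine iSup_le fun p => iSup_le fun q => ?_
    rw [map_nabla_inf_delta, map_nabla_inf_delta, inf_inf_inf_comm, ← nabla_inf, ← delta_sup,
      ← InfHomClass.map_inf h, ← SupHomClass.map_sup h, ← map_nabla_inf_delta]
    refine (gc h).monotone_l ?_
    rw [nabla_inf, delta_sup, inf_inf_inf_comm]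
    refine inf_le_inf ?_ ?_
    · conv_rhs => rw [eq_iSup θ]
      first
        | exact le_iSup (fun p : {p : L × L // θ.r p.1 p.2} => nabla p.1.1 ⊓ delta p.1.2) p
        | exact le_iSup (fun p : {p : L × L // θ.r p.1 p.2} => nabla p.1.1 ⊓ delta p.1.2) q
    · conv_rhs => rw [eq_iSup φ]
      first
        | exact le_iSup (fun p : {p : L × L // φ.r p.1 p.2} => nabla p.1.1 ⊓ delta p.1.2) q
        | exact le_iSup (fun p : {p : L × L // φ.r p.1 p.2} => nabla p.1.1 ⊓ delta p.1.2) p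

/-- The frame homomorphism between congruence frames induced by a frame homomorphism. -/
def mapHom (h : FrameHom L M) : FrameHom (FrameCon L) (FrameCon M) where
  toFun := map h
  map_inf' := map_inf h
  map_top' := by
    rw [eq_top_iff]
    have h1 : (⊤ : FrameCon L) = nabla ⊤ := by
      rw [eq_comm, eq_top_iff]
      intro x y _
      simp [nabla]
    have h2 : (⊤ : FrameCon M) ≤ nabla ⊤ := by
      intro x y _
      simp [nabla]
    rw [h1, map_nabla, TopHomClass.map_top h]
    exact h2
  map_sSup' A := by rw [(gc h).l_sSup, sSup_image]

theorem mapHom_apply (h : FrameHom L M) (θ : FrameCon L) : mapHom h θ = map h θ := rfl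

theorem map_id (θ : FrameCon L) : map (FrameHom.id L) θ = θ :=
  le_antisymm ((gc _).l_le fun _ _ h => h) fun _ _ h => (gc (FrameHom.id L)).le_u_l θ _ _ h

theorem map_comp (g : FrameHom M N) (f : FrameHom L M) (θ : FrameCon L) :
    map (g.comp f) θ = map g (map f θ) :=
  le_antisymm
    ((gc _).l_le fun _ _ h => (gc g).le_u_l _ _ _ ((gc f).le_u_l θ _ _ h))
    ((gc g).l_le ((gc f).l_le fun _ _ h => (gc (g.comp f)).le_u_l θ _ _ h))

/-- `∇S`: the subframe of the congruence frame generated by the `∇ₛ`, `s ∈ S`. -/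
def nablaSub (S : Set L) : Subframe (FrameCon L) := Subframe.closure (nabla '' S)

/-- `ΔS`: the subframe of the congruence frame generated by the `Δₛ`, `s ∈ S`. -/
def deltaSub (S : Set L) : Subframe (FrameCon L) := Subframe.closure (delta '' S)

/-- `𝒞_S L`: the subframe of the congruence frame generated by `∇L ∪ ΔS`. -/
def relSub (S : Set L) : Subframe (FrameCon L) :=
  Subframe.closure ((nablaSub (Set.univ : Set L) : Set (FrameCon L)) ∪ deltaSub S)

theorem nablaSub_le_relSub (S : Set L) : ∀ θ ∈ nablaSub (Set.univ : Set L), θ ∈ relSub S :=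
  fun _ hθ => Subframe.subset_closure _ (Or.inl hθ)

theorem deltaSub_le_relSub (S : Set L) : ∀ θ ∈ deltaSub S, θ ∈ relSub S :=
  fun _ hθ => Subframe.subset_closure _ (Or.inr hθ)

theorem map_mem_nablaSub (h : FrameHom L M) :
    ∀ θ ∈ nablaSub (Set.univ : Set L), map h θ ∈ nablaSub (Set.univ : Set M) :=
  Subframe.closure_le (T := Subframe.comap (mapHom h) (nablaSub Set.univ)) (by
    rintro _ ⟨a, _, rfl⟩
    show map h (nabla a) ∈ nablaSub Set.univ
    rw [map_nabla]
    exact Subframe.subset_closure _ ⟨h a, trivial, rfl⟩)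

theorem map_mem_deltaSub (h : FrameHom L M) {S : Set L} {T : Set M} (hST : ∀ s ∈ S, h s ∈ T) :
    ∀ θ ∈ deltaSub S, map h θ ∈ deltaSub T :=
  Subframe.closure_le (T := Subframe.comap (mapHom h) (deltaSub T)) (by
    rintro _ ⟨a, ha, rfl⟩
    show map h (delta a) ∈ deltaSub T
    rw [map_delta]
    exact Subframe.subset_closure _ ⟨h a, hST a ha, rfl⟩)

theorem map_mem_relSub (h : FrameHom L M) {S : Set L} {T : Set M} (hST : ∀ s ∈ S, h s ∈ T) :
    ∀ θ ∈ relSub S, map h θ ∈ relSub T :=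
  Subframe.closure_le (T := Subframe.comap (mapHom h) (relSub T)) (by
    rintro θ (hθ | hθ)
    · exact nablaSub_le_relSub T _ (map_mem_nablaSub h θ hθ)
    · exact deltaSub_le_relSub T _ (map_mem_deltaSub h hST θ hθ))

end FrameCon

/-! ### Frith frames -/

/-- A Frith frame `(L, S)`: a frame with a join-dense bounded sublattice. -/
structure FrithFrame where
  carrier : Type u
  [frame : Order.Frame carrier]
  lat : Sublattice carrier
  bot_mem : ⊥ ∈ lat
  top_mem : ⊤ ∈ lat
  joinDense : ∀ a : carrier, ∃ A : Set carrier, A ⊆ lat ∧ sSup A = a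

attribute [instance] FrithFrame.frame

namespace FrithFrame

/-- A morphism of Frith frames: a frame homomorphism `h` with `h[S] ⊆ T`. -/
@[ext]
structure Hom (X Y : FrithFrame.{u}) where
  toFrameHom : FrameHom X.carrier Y.carrier
  map_lat : ∀ s ∈ X.lat, toFrameHom s ∈ Y.lat

instance : Category FrithFrame.{u} where
  Hom := Hom
  id X := ⟨FrameHom.id X.carrier, fun _ hs => hs⟩
  comp f g := ⟨g.toFrameHom.comp f.toFrameHom, fun s hs => g.map_lat _ (f.map_lat s hs)⟩

/-- The meet of `P` is strongly exact: the congruence `⋁_{s ∈ P} Δₛ` is open. -/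
def _root_.IsStronglyExactMeet {L : Type u} [Order.Frame L] (P : Set L) : Prop :=
  ∃ a : L, ⨆ s ∈ P, FrameCon.delta s = FrameCon.delta a

/-- `(L, S)` is strongly exact: `S` is closed under strongly exact meets. -/
def IsStronglyExact : ObjectProperty FrithFrame.{u} := fun X =>
  ∀ P : Set X.carrier, P ⊆ X.lat → IsStronglyExactMeet P → sInf P ∈ X.lat

end FrithFrame

/-! ### Biframes -/

/-- A biframe `(L, L₊, L₋)`: a frame with two subframes such that every element of `L` is a join of
finite meets of elements of `L₊ ∪ L₋`. -/
structure Biframe where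
  carrier : Type u
  [frame : Order.Frame carrier]
  pos : Subframe carrier
  neg : Subframe carrier
  gen : ∀ x : carrier, ∃ A : Set carrier,
    (∀ y ∈ A, ∃ F : Finset carrier, (↑F : Set carrier) ⊆ (pos : Set carrier) ∪ neg ∧
      F.inf id = y) ∧ sSup A = x

attribute [instance] Biframe.frame

namespace Biframe

/-- A morphism of biframes: a frame homomorphism with `h[L₊] ⊆ M₊` and `h[L₋] ⊆ M₋`. -/
@[ext]
structure Hom (K L : Biframe.{u}) where
  toFrameHom : FrameHom K.carrier L.carrier
  map_pos : ∀ x ∈ K.pos, toFrameHom x ∈ L.pos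
  map_neg : ∀ x ∈ K.neg, toFrameHom x ∈ L.neg

instance : Category Biframe.{u} where
  Hom := Hom
  id K := ⟨FrameHom.id K.carrier, fun _ hx => hx, fun _ hx => hx⟩
  comp f g := ⟨g.toFrameHom.comp f.toFrameHom, fun x hx => g.map_pos _ (f.map_pos x hx),
    fun x hx => g.map_neg _ (f.map_neg x hx)⟩

/-- `a ∈ L₊` is complemented in `L` with complement in `L₋`. -/
def IsPosBicomplemented (K : Biframe.{u}) (a : K.carrier) : Prop :=
  a ∈ K.pos ∧ ∃ b ∈ K.neg, IsCompl a b

/-- `a ∈ L₋` is complemented in `L` with complement in `L₊`. -/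
def IsNegBicomplemented (K : Biframe.{u}) (a : K.carrier) : Prop :=
  a ∈ K.neg ∧ ∃ b ∈ K.pos, IsCompl a b

/-- `L₊` and `L₋` are join-generated by their bicomplemented elements. -/
def IsZeroDimensional : ObjectProperty Biframe.{u} := fun K =>
  (∀ x ∈ K.pos, ∃ A : Set K.carrier, (∀ a ∈ A, K.IsPosBicomplemented a) ∧ sSup A = x) ∧
  (∀ x ∈ K.neg, ∃ A : Set K.carrier, (∀ a ∈ A, K.IsNegBicomplemented a) ∧ sSup A = x)

/-- The main component is a compact frame. -/
def IsCompactBiframe (K : Biframe.{u}) : Prop := IsCompactElement (⊤ : K.carrier)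

/-- The subframe `⟨𝔹₊(𝓛)⟩` generated by the positive bicomplemented elements. As `L₊` is a subframe
of `L`, generating in `L₊` and in `L` gives the same subframe. -/
def bicompSub (K : Biframe.{u}) : Subframe K.carrier :=
  Subframe.closure {a | K.IsPosBicomplemented a}

theorem IsPosBicomplemented.sup {K : Biframe.{u}} {a b : K.carrier}
    (ha : K.IsPosBicomplemented a) (hb : K.IsPosBicomplemented b) :
    K.IsPosBicomplemented (a ⊔ b) := by
  obtain ⟨ha, a', ha', hac⟩ := ha
  obtain ⟨hb, b', hb', hbc⟩ := hb
  exact ⟨K.pos.sup_mem ha hb, a' ⊓ b', K.neg.inf_mem ha' hb', hac.sup_inf hbc⟩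

theorem IsPosBicomplemented.inf {K : Biframe.{u}} {a b : K.carrier}
    (ha : K.IsPosBicomplemented a) (hb : K.IsPosBicomplemented b) :
    K.IsPosBicomplemented (a ⊓ b) := by
  obtain ⟨ha, a', ha', hac⟩ := ha
  obtain ⟨hb, b', hb', hbc⟩ := hb
  exact ⟨K.pos.inf_mem ha hb, a' ⊔ b', K.neg.sup_mem ha' hb', hac.inf_sup hbc⟩

theorem isPosBicomplemented_top (K : Biframe.{u}) : K.IsPosBicomplemented ⊤ :=
  ⟨K.pos.top_mem, ⊥, K.neg.bot_mem, isCompl_top_bot⟩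

theorem isPosBicomplemented_bot (K : Biframe.{u}) : K.IsPosBicomplemented ⊥ :=
  ⟨K.pos.bot_mem, ⊤, K.neg.top_mem, isCompl_bot_top⟩

theorem Hom.map_isPosBicomplemented {K L : Biframe.{u}} (f : Hom K L) {a : K.carrier}
    (ha : K.IsPosBicomplemented a) : L.IsPosBicomplemented (f.toFrameHom a) := by
  obtain ⟨ha, b, hb, hab⟩ := ha
  refine ⟨f.map_pos a ha, _, f.map_neg b hb, ?_⟩
  rw [isCompl_iff, disjoint_iff, codisjoint_iff, ← map_inf, ← map_sup, hab.inf_eq_bot,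
    hab.sup_eq_top]
  exact ⟨map_bot _, map_top _⟩

/-- The Frith frame `(⟨𝔹₊(𝓛)⟩, 𝔹₊(𝓛))`. -/
def toFrith (K : Biframe.{u}) : FrithFrame.{u} where
  carrier := K.bicompSub
  lat :=
    { carrier := {x | K.IsPosBicomplemented x.1}
      supClosed' := fun _ ha _ hb => IsPosBicomplemented.sup ha hb
      infClosed' := fun _ ha _ hb => IsPosBicomplemented.inf ha hb }
  bot_mem := K.isPosBicomplemented_bot
  top_mem := K.isPosBicomplemented_top
  joinDense := by
    let P : Set K.bicompSub := {x | K.IsPosBicomplemented x.1}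
    have key : ∀ x ∈ K.bicompSub, x ∈ Subframe.lift (Subframe.joinsOfMeets P) :=
      Subframe.closure_le (by
        intro x hx
        exact ⟨Subframe.subset_closure _ hx, Subframe.subset_joinsOfMeets P hx⟩)
    intro a
    obtain ⟨_, A, hA, hsup⟩ := key a.1 a.2
    refine ⟨A, fun y hy => ?_, hsup⟩
    obtain ⟨F, hF, rfl⟩ := hA y hy
    refine Finset.inf_induction (p := fun x : K.bicompSub => K.IsPosBicomplemented x.1)
      K.isPosBicomplemented_top (fun a ha b hb => IsPosBicomplemented.inf ha hb)
      (fun b hb => hF hb)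

theorem Hom.map_bicompSub {K L : Biframe.{u}} (f : Hom K L) :
    ∀ x ∈ K.bicompSub, f.toFrameHom x ∈ L.bicompSub :=
  Subframe.closure_le (T := Subframe.comap f.toFrameHom L.bicompSub)
    fun _ hx => Subframe.subset_closure _ (f.map_isPosBicomplemented hx)

end Biframe

/-- The functor `𝔹₊` from biframes to Frith frames; on morphisms it restricts and co-restricts. -/
def posBicompFunctor : Biframe.{u} ⥤ FrithFrame.{u} where
  obj K := K.toFrith
  map {K L} f :=
    { toFrameHom := f.toFrameHom.restrictSubframe K.bicompSub L.bicompSub f.map_bicompSub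
      map_lat := fun _ hs => f.map_isPosBicomplemented hs }
  map_id _ := rfl
  map_comp _ _ := rfl

namespace FrithFrame

/-- The biframe `(𝒞_S L, ∇L, ΔS)` of a Frith frame `(L, S)`. -/
def toBiframe (X : FrithFrame.{u}) : Biframe.{u} where
  carrier := FrameCon.relSub (X.lat : Set X.carrier)
  pos := Subframe.within _ (FrameCon.nablaSub Set.univ)
  neg := Subframe.within _ (FrameCon.deltaSub (X.lat : Set X.carrier))
  gen := by
    intro x
    let C := FrameCon.relSub (X.lat : Set X.carrier)
    let P : Set C := (Subframe.within C (FrameCon.nablaSub Set.univ) : Set C) ∪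
      (Subframe.within C (FrameCon.deltaSub (X.lat : Set X.carrier)) : Set C)
    have key : ∀ y ∈ C, y ∈ Subframe.lift (Subframe.joinsOfMeets P) :=
      Subframe.closure_le (T := Subframe.lift (Subframe.joinsOfMeets P)) (by
        rintro y (hy | hy)
        · exact ⟨FrameCon.nablaSub_le_relSub _ y hy,
            Subframe.subset_joinsOfMeets P (Or.inl hy)⟩
        · exact ⟨FrameCon.deltaSub_le_relSub _ y hy,
            Subframe.subset_joinsOfMeets P (Or.inr hy)⟩)
    obtain ⟨_, h⟩ := key x.1 x.2
    exact h

end FrithFrame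

/-- The functor `(L, S) ↦ (𝒞_S L, ∇L, ΔS)` from Frith frames to biframes. A morphism `h` is sent to
its extension to congruences, which satisfies `∇ₐ ↦ ∇_{h a}` and `Δₐ ↦ Δ_{h a}`. -/
def skulaFunctor : FrithFrame.{u} ⥤ Biframe.{u} where
  obj X := X.toBiframe
  map {X Y} h :=
    { toFrameHom := (FrameCon.mapHom h.toFrameHom).restrictSubframe
        (FrameCon.relSub (X.lat : Set X.carrier)) (FrameCon.relSub (Y.lat : Set Y.carrier))
        (FrameCon.map_mem_relSub h.toFrameHom h.map_lat)
      map_pos := fun θ hθ => FrameCon.map_mem_nablaSub h.toFrameHom θ.1 hθ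
      map_neg := fun θ hθ => FrameCon.map_mem_deltaSub h.toFrameHom h.map_lat θ.1 hθ }
  map_id _ := Biframe.Hom.ext (DFunLike.ext _ _ fun θ => Subtype.ext (FrameCon.map_id θ.1))
  map_comp f g := Biframe.Hom.ext (DFunLike.ext _ _ fun θ =>
    Subtype.ext (FrameCon.map_comp g.toFrameHom f.toFrameHom θ.1))

/-- The congruence underlying an element of the main component of `𝔹₊(𝒞_S L, ∇L, ΔS)`, which is a
subframe of `𝒞_S L`. -/
def FrithFrame.underlyingCon (X : FrithFrame.{u})
    (θ : ((skulaFunctor.{u} ⋙ posBicompFunctor.{u}).obj X).carrier) : FrameCon X.carrier :=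
  θ.1.1

/-- An adjunction `F ⊣ G` is idempotent: the counit is invertible at every `F X` and the unit is
invertible at every `G Y` (each of the two conditions implies the other). -/
def CategoryTheory.Adjunction.IsIdempotentAdjunction {C D : Type*} [Category* C] [Category* D]
    {F : C ⥤ D} {G : D ⥤ C} (adj : F ⊣ G) : Prop :=
  (∀ X : C, IsIso (adj.counit.app (F.obj X))) ∧ ∀ Y : D, IsIso (adj.unit.app (G.obj Y))

/-! Everything rests on a universal property of `𝒞_S L`: a frame homomorphism `f : L → M` that sends
each `s ∈ S` to a complemented element extends uniquely along `a ↦ ∇ₐ`. The induced map `𝒞L → 𝒞M`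
sends `Δₛ` to `Δ_{f s}`, which equals `∇_c` for the complement `c` of `f s`; so it carries `𝒞_S L`
into `∇M`, a copy of `M` (`FrameCon.extend`). Uniqueness holds because complements are unique
(`FrameCon.relSub_hom_ext`). Read for biframes, this is the adjunction.

The unit is always bijective on underlying frames, so it is invertible exactly when `S` contains
every `a` with `∇ₐ` positive bicomplemented. Since the complement of `∇ₐ` can only be `Δₐ`, this
condition on `a` says that `Δₐ` is a join of congruences `Δₛ` with `s ∈ S`, that is, `a` is a
strongly exact meet of elements of `S` (`isStronglyExact_iff`).

For a biframe `K`, the counit sends `∇ₐ` to `a` and preserves bicomplements; hence `a` is positive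
bicomplemented in `K` as soon as `∇ₐ` is, and `𝔹₊(K)` is strongly exact. Thus the unit is invertible
on the image of `𝔹₊`, and idempotency is formal.

The counit reflects `⊥` for every `K`. Its source has a join-basis of complemented elements `∇ₛ ∧
Δₜ`, so when `K` is compact the counit also reflects `⊤` and is therefore injective;
zero-dimensionality makes it onto on both parts. -/

namespace Subframe

/-! ### Subframes: generation, equalizers and images -/

variable {L M : Type u} [Order.Frame L] [Order.Frame M]

/-- The subframe generated by a set closed under finite meets consists of the joins of its
subsets. -/
theorem exists_sSup_eq_of_mem_closure {P : Set L} (htop : ⊤ ∈ P)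
    (hinf : ∀ a ∈ P, ∀ b ∈ P, a ⊓ b ∈ P) {x : L} (hx : x ∈ closure P) :
    ∃ A ⊆ P, sSup A = x := by
  obtain ⟨A, hA, h⟩ := closure_le (subset_joinsOfMeets P) x hx
  refine ⟨A, fun y hy => ?_, h⟩
  obtain ⟨F, hF, rfl⟩ := hA y hy
  exact Finset.inf_induction (p := (· ∈ P)) htop (fun a ha b hb => hinf a ha b hb)
    fun b hb => hF hb

/-- The inclusion of a subframe. -/
def subtype (T : Subframe L) : FrameHom T L where
  toFun := Subtype.val
  map_inf' _ _ := rfl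
  map_top' := rfl
  map_sSup' _ := rfl

theorem isCompl_coe {T : Subframe L} {x y : T} : IsCompl x.1 y.1 ↔ IsCompl x y := by
  simp only [isCompl_iff, disjoint_iff, codisjoint_iff, Subtype.ext_iff, coe_inf, coe_sup,
    coe_bot, coe_top]

/-- The elements on which two frame homomorphisms agree. -/
def eqLocus (f g : FrameHom L M) : Subframe L where
  carrier := {x | f x = g x}
  top_mem' := by simp
  inf_mem' {a b} (ha : f a = g a) (hb : f b = g b) := by
    show f (a ⊓ b) = g (a ⊓ b)
    rw [map_inf, map_inf, ha, hb]
  sSup_mem' A hA := by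
    show f (sSup A) = g (sSup A)
    rw [map_sSup, map_sSup]
    exact congrArg sSup (Set.image_congr hA)

/-- The image of a frame homomorphism. -/
def range (f : FrameHom L M) : Subframe M where
  carrier := Set.range f
  top_mem' := ⟨⊤, map_top f⟩
  inf_mem' := by
    rintro _ _ ⟨a, rfl⟩ ⟨b, rfl⟩
    exact ⟨a ⊓ b, map_inf f a b⟩
  sSup_mem' A hA := by
    refine ⟨sSup (f ⁻¹' A), ?_⟩
    rw [map_sSup, Set.image_preimage_eq_of_subset hA]

end Subframe

/-- Co-restriction of a frame homomorphism to a subframe. -/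
def FrameHom.codRestrict {L M : Type u} [Order.Frame L] [Order.Frame M]
    (h : FrameHom L M) (U : Subframe M) (hU : ∀ x, h x ∈ U) : FrameHom L U where
  toFun x := ⟨h x, hU x⟩
  map_inf' x y := Subtype.ext (map_inf h x y)
  map_top' := Subtype.ext (map_top h)
  map_sSup' A := Subtype.ext (by
    show h (sSup A) = sSup (Subtype.val '' _)
    rw [map_sSup, Set.image_image])

/-! ### Closed and open congruences, and the universal property of `𝒞_S L` -/

namespace FrameCon

variable {L M : Type u} [Order.Frame L] [Order.Frame M]

theorem nabla_le_nabla {a b : L} : nabla a ≤ nabla b ↔ a ≤ b := by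
  rw [nabla_le]
  show b ⊔ a = b ⊔ ⊥ ↔ a ≤ b
  simp

theorem delta_le_delta {a b : L} : delta a ≤ delta b ↔ b ≤ a := by
  rw [delta_le]
  show b ⊓ a = b ⊓ ⊤ ↔ b ≤ a
  simp

theorem nabla_injective : Function.Injective (nabla : L → FrameCon L) := fun _ _ h =>
  le_antisymm (nabla_le_nabla.1 h.le) (nabla_le_nabla.1 h.ge)

theorem eq_top_of_r {θ : FrameCon L} (h : θ.r ⊤ ⊥) : θ = ⊤ := by
  have key : ∀ x, θ.r x ⊥ := fun x => by simpa using θ.inf' h (θ.iseqv.refl x)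
  exact eq_top_iff.2 fun x y _ => θ.iseqv.trans (key x) (θ.iseqv.symm (key y))

theorem nabla_top : nabla (⊤ : L) = ⊤ := eq_top_of_r (by simp [nabla])

theorem delta_bot : delta (⊥ : L) = ⊤ := eq_top_of_r (by simp [delta])

theorem nabla_sSup (A : Set L) : nabla (sSup A) = ⨆ a ∈ A, nabla a := by
  apply le_antisymm
  · rw [nabla_le, sSup_eq_iSup']
    have h := (⨆ a ∈ A, nabla a).iSup' (fun a : A => (a : L)) (fun _ => ⊥)
      fun a => nabla_le.1 (le_iSup₂ (f := fun (a : L) (_ : a ∈ A) => nabla a) a.1 a.2)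
    simpa using h
  · exact iSup₂_le fun a ha => nabla_le_nabla.2 (le_sSup ha)

theorem isCompl_nabla_delta (a : L) : IsCompl (nabla a) (delta a) := by
  rw [isCompl_iff, disjoint_iff, codisjoint_iff]
  constructor
  · rw [eq_bot_iff, nabla_inf_delta_le, sup_idem]
    exact FrameCon.iseqv _ |>.refl a
  · refine eq_top_of_r ?_
    have h₁ := nabla_le.1 (le_sup_left : nabla a ≤ nabla a ⊔ delta a)
    have h₂ := delta_le.1 (le_sup_right : delta a ≤ nabla a ⊔ delta a)
    exact FrameCon.iseqv _ |>.trans (FrameCon.iseqv _ |>.symm h₂) h₁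

/-- One inclusion is `a ∧ b = ⊥`, the other `a ∨ b = ⊤`. This turns open congruences at complemented
elements into closed ones. -/
theorem nabla_eq_delta {a b : L} (h : IsCompl a b) : nabla b = delta a := by
  apply le_antisymm
  · rw [nabla_le]
    show a ⊓ b = a ⊓ ⊥
    rw [h.inf_eq_bot, inf_bot_eq]
  · rw [delta_le]
    show b ⊔ a = b ⊔ ⊤
    rw [sup_comm, h.sup_eq_top, sup_top_eq]

/-- The embedding of a frame in its congruence frame by closed congruences. -/
def nablaHom (L : Type u) [Order.Frame L] : FrameHom L (FrameCon L) where
  toFun := nabla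
  map_inf' := nabla_inf
  map_top' := nabla_top
  map_sSup' A := by rw [nabla_sSup, sSup_image]

theorem nabla_mem_nablaSub (a : L) : nabla a ∈ nablaSub (Set.univ : Set L) :=
  Subframe.subset_closure _ ⟨a, trivial, rfl⟩

theorem delta_mem_deltaSub {S : Set L} {s : L} (hs : s ∈ S) : delta s ∈ deltaSub S :=
  Subframe.subset_closure _ ⟨s, hs, rfl⟩

theorem nabla_mem_relSub (S : Set L) (a : L) : nabla a ∈ relSub S :=
  nablaSub_le_relSub S _ (nabla_mem_nablaSub a)

theorem delta_mem_relSub {S : Set L} {s : L} (hs : s ∈ S) : delta s ∈ relSub S :=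
  deltaSub_le_relSub S _ (delta_mem_deltaSub hs)

theorem mem_nablaSub {θ : FrameCon L} : θ ∈ nablaSub (Set.univ : Set L) ↔ ∃ a, nabla a = θ := by
  constructor
  · exact Subframe.closure_le (T := Subframe.range (nablaHom L)) (by
      rintro _ ⟨a, _, rfl⟩
      exact ⟨a, rfl⟩) θ
  · rintro ⟨a, rfl⟩
    exact nabla_mem_nablaSub a

/-- A frame is isomorphic to the frame of its closed congruences. -/
noncomputable def nablaIso (L : Type u) [Order.Frame L] :
    L ≃o nablaSub (Set.univ : Set L) where
  toEquiv := Equiv.ofBijective (fun a => ⟨nabla a, nabla_mem_nablaSub a⟩)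
    ⟨fun _ _ h => nabla_injective (congrArg Subtype.val h), fun θ => by
      obtain ⟨a, ha⟩ := mem_nablaSub.1 θ.2
      exact ⟨a, Subtype.ext ha⟩⟩
  map_rel_iff' := nabla_le_nabla

theorem nabla_nablaIso_symm (θ : nablaSub (Set.univ : Set L)) :
    nabla ((nablaIso L).symm θ) = θ.1 :=
  congrArg Subtype.val ((nablaIso L).apply_symm_apply θ)

/-- Because `Δₛ ∧ Δₜ = Δ_{s ∨ t}` and `Δ_⊥ = ⊤`, the generators are already closed under finite
meets, and only joins remain to be added. -/
theorem mem_deltaSub (S : Sublattice L) (hbot : ⊥ ∈ S) {θ : FrameCon L} :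
    θ ∈ deltaSub (S : Set L) ↔ ∃ P ⊆ (S : Set L), ⨆ s ∈ P, delta s = θ := by
  constructor
  · intro h
    obtain ⟨A, hA, rfl⟩ := Subframe.exists_sSup_eq_of_mem_closure (P := delta '' (S : Set L))
      ⟨⊥, hbot, delta_bot⟩ (by
      rintro _ ⟨s, hs, rfl⟩ _ ⟨t, ht, rfl⟩
      exact ⟨s ⊔ t, S.supClosed hs ht, delta_sup s t⟩) h
    obtain ⟨P, hP, rfl⟩ := Set.subset_image_iff.1 hA
    exact ⟨P, hP, sSup_image.symm⟩
  · rintro ⟨P, hP, rfl⟩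
    rw [← sSup_image]
    refine Subframe.sSup_mem _ ?_
    rintro _ ⟨s, hs, rfl⟩
    exact delta_mem_deltaSub (hP hs)

/-- If the meet of `P` is strongly exact, the witnessing open congruence is that of the meet. -/
theorem eq_sInf_of_iSup_delta_eq {P : Set L} {a : L} (h : ⨆ s ∈ P, delta s = delta a) :
    a = sInf P := by
  apply le_antisymm
  · refine le_sInf fun s hs => delta_le_delta.1 (h ▸ ?_)
    exact le_iSup₂ (f := fun (s : L) (_ : s ∈ P) => delta s) s hs
  · refine delta_le_delta.1 (h ▸ iSup₂_le fun s hs => delta_le_delta.2 (sInf_le hs))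

/-- Join-density of `S` reduces each `∇ₐ` to the `∇ₛ` with `s ∈ S`, so the join-basis obtained
consists of complemented elements. -/
theorem exists_of_mem_relSub (S : Sublattice L) (hbot : ⊥ ∈ S) (htop : ⊤ ∈ S)
    (hS : ∀ a : L, ∃ A : Set L, A ⊆ S ∧ sSup A = a) {θ : FrameCon L}
    (hθ : θ ∈ relSub (S : Set L)) :
    ∃ A ⊆ {φ | ∃ s ∈ S, ∃ t ∈ S, nabla s ⊓ delta t = φ}, sSup A = θ := by
  set P : Set (FrameCon L) := {φ | ∃ s ∈ S, ∃ t ∈ S, nabla s ⊓ delta t = φ}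
  -- The other factor is made trivial by `Δ_⊥ = ⊤` here and by `∇_⊤ = ⊤` in the next line.
  have hn : ∀ s ∈ S, nabla s ∈ P := fun s hs => ⟨s, hs, ⊥, hbot, by simp [delta_bot]⟩
  have hd : ∀ s ∈ S, delta s ∈ P := fun s hs => ⟨⊤, htop, s, hs, by simp [nabla_top]⟩
  refine Subframe.exists_sSup_eq_of_mem_closure (P := P) ?_ ?_ ?_
  · exact nabla_top (L := L) ▸ hn ⊤ htop
  · rintro _ ⟨s, hs, t, ht, rfl⟩ _ ⟨s', hs', t', ht', rfl⟩
    exact ⟨s ⊓ s', S.infClosed hs hs', t ⊔ t', S.supClosed ht ht', by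
      rw [nabla_inf, delta_sup, inf_inf_inf_comm]⟩
  · refine Subframe.closure_le (Set.union_subset ?_ ?_) θ hθ
    · refine Subframe.closure_le (T := Subframe.closure P) ?_
      rintro _ ⟨a, _, rfl⟩
      obtain ⟨A, hA, rfl⟩ := hS a
      rw [SetLike.mem_coe, nabla_sSup, ← sSup_image]
      refine Subframe.sSup_mem _ ?_
      rintro _ ⟨s, hs, rfl⟩
      exact Subframe.subset_closure _ (hn s (hA hs))
    · refine Subframe.closure_le (T := Subframe.closure P) ?_
      rintro _ ⟨s, hs, rfl⟩
      exact Subframe.subset_closure _ (hd s hs)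

/-- A frame homomorphism out of `𝒞_S L` is determined by its values on the closed congruences. -/
theorem relSub_hom_ext {S : Set L} {f g : FrameHom (relSub S) M}
    (h : ∀ a, f ⟨nabla a, nabla_mem_relSub S a⟩ = g ⟨nabla a, nabla_mem_relSub S a⟩) : f = g := by
  -- `Δₛ` is the complement of `∇ₛ` in `𝒞_S L`; both homomorphisms preserve this, and complements in
  -- `M` are unique.
  have hd : ∀ s (hs : s ∈ S),
      f ⟨delta s, delta_mem_relSub hs⟩ = g ⟨delta s, delta_mem_relSub hs⟩ := by
    intro s hs
    have hc : IsCompl (⟨nabla s, nabla_mem_relSub S s⟩ : relSub S)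
        ⟨delta s, delta_mem_relSub hs⟩ := Subframe.isCompl_coe.1 (isCompl_nabla_delta s)
    have hg := hc.map g
    rw [← h s] at hg
    exact (hc.map f).right_unique hg
  refine DFunLike.ext _ _ fun θ => ?_
  obtain ⟨_, hθ⟩ := Subframe.closure_le (T := Subframe.lift (Subframe.eqLocus f g))
    (Set.union_subset
      (Subframe.closure_le (T := Subframe.lift (Subframe.eqLocus f g)) (by
        rintro _ ⟨a, _, rfl⟩
        exact ⟨nabla_mem_relSub S a, h a⟩))
      (Subframe.closure_le (T := Subframe.lift (Subframe.eqLocus f g)) (by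
        rintro _ ⟨s, hs, rfl⟩
        exact ⟨delta_mem_relSub hs, hd s hs⟩))) θ.1 θ.2
  exact hθ

/-- On generators, `Δₛ` goes to `Δ_{f s} = ∇_c` with `c` the complement of `f s`. -/
theorem map_mem_nablaSub_of_isCompl (f : FrameHom L M) {S : Set L}
    (hf : ∀ s ∈ S, ∃ c, IsCompl (f s) c) :
    ∀ θ ∈ relSub S, mapHom f θ ∈ nablaSub (Set.univ : Set M) := by
  refine Subframe.closure_le (T := Subframe.comap (mapHom f) (nablaSub Set.univ))
    (Set.union_subset (map_mem_nablaSub f) (Subframe.closure_le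
      (T := Subframe.comap (mapHom f) (nablaSub Set.univ)) ?_))
  rintro _ ⟨s, hs, rfl⟩
  obtain ⟨c, hc⟩ := hf s hs
  exact mem_nablaSub.2 ⟨c, (nabla_eq_delta hc).trans (map_delta f s).symm⟩

/-- The extension to `𝒞_S L` of a frame homomorphism that sends the elements of `S` to complemented
elements. -/
noncomputable def extend (f : FrameHom L M) {S : Set L} (hf : ∀ s ∈ S, ∃ c, IsCompl (f s) c) :
    FrameHom (relSub S) M :=
  -- The induced map of congruence frames lands in `∇M`, which is then identified with `M`.
  FrameHom.comp ((nablaIso M).symm : FrameHom (nablaSub (Set.univ : Set M)) M)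
    ((mapHom f).restrictSubframe _ _ (map_mem_nablaSub_of_isCompl f hf))

variable (f : FrameHom L M) {S : Set L} (hf : ∀ s ∈ S, ∃ c, IsCompl (f s) c)

theorem nabla_extend (θ : relSub S) : nabla (extend f hf θ) = map f θ.1 :=
  nabla_nablaIso_symm _

theorem extend_nabla {θ : relSub S} {a : L} (h : nabla a = θ.1) : extend f hf θ = f a := by
  apply nabla_injective
  rw [nabla_extend, ← h, map_nabla]

theorem extend_delta {θ : relSub S} {s : L} (h : delta s = θ.1) {c : M} (hc : IsCompl (f s) c) :
    extend f hf θ = c := by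
  apply nabla_injective
  rw [nabla_extend, ← h, map_delta, nabla_eq_delta hc]

end FrameCon

/-! ### Idempotency of an adjunction from its unit -/

namespace CategoryTheory.Adjunction

/-- If the unit of an adjunction is invertible on the image of the right adjoint, then the counit is
invertible on the image of the left adjoint. -/
theorem isIso_counit_app_obj {C D : Type*} [Category* C] [Category* D] {F : C ⥤ D} {G : D ⥤ C}
    (adj : F ⊣ G) (h : ∀ Y, IsIso (adj.unit.app (G.obj Y))) (X : C) :
    IsIso (adj.counit.app (F.obj X)) := by
  -- By the two triangle identities both sides are sections of `G.map (adj.counit.app (F.obj X))`,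
  -- which is invertible, being inverse to an invertible unit component.
  have key : G.map (F.map (adj.unit.app X)) = adj.unit.app (G.obj (F.obj X)) := by
    have h₁ := adj.right_triangle_components (F.obj X)
    have h₂ : G.map (F.map (adj.unit.app X)) ≫ G.map (adj.counit.app (F.obj X)) = 𝟙 _ :=
      (G.map_comp _ _).symm.trans
        ((congrArg G.map (adj.left_triangle_components X)).trans (G.map_id _))
    have : IsIso (G.map (adj.counit.app (F.obj X))) := by
      rw [(IsIso.eq_inv_of_hom_inv_id h₁)]
      infer_instance
    exact (cancel_mono (G.map (adj.counit.app (F.obj X)))).1 (h₂.trans h₁.symm)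
  refine ⟨F.map (adj.unit.app X), ?_, adj.left_triangle_components X⟩
  have h₁ := adj.counit.naturality (F.map (adj.unit.app X))
  have h₂ := adj.left_triangle_components (G.obj (F.obj X))
  dsimp at h₁
  rw [← h₁, key]
  exact h₂

end CategoryTheory.Adjunction

theorem FrithFrame.comp_apply {X Y Z : FrithFrame.{u}} (f : X ⟶ Y) (g : Y ⟶ Z) (a : X.carrier) :
    Hom.toFrameHom (f ≫ g) a = Hom.toFrameHom g (Hom.toFrameHom f a) := rfl

/-- The inverse of a bijective frame homomorphism. -/
noncomputable def FrameHom.inverse {L M : Type u} [Order.Frame L] [Order.Frame M]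
    (h : FrameHom L M) (hb : Function.Bijective h) : FrameHom M L where
  toFun := (Equiv.ofBijective h hb).symm
  map_inf' x y := hb.1 (by simp [Equiv.ofBijective_apply_symm_apply])
  map_top' := hb.1 (by simp [Equiv.ofBijective_apply_symm_apply])
  map_sSup' A := hb.1 (by
    rw [map_sSup h, Set.image_image]
    simp only [Equiv.ofBijective_apply_symm_apply, Set.image_id'])

theorem FrameHom.apply_inverse {L M : Type u} [Order.Frame L] [Order.Frame M]
    (h : FrameHom L M) (hb : Function.Bijective h) (x : M) : h (h.inverse hb x) = x :=
  Equiv.ofBijective_apply_symm_apply h hb x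

theorem FrameHom.inverse_apply {L M : Type u} [Order.Frame L] [Order.Frame M]
    (h : FrameHom L M) (hb : Function.Bijective h) (x : L) : h.inverse hb (h x) = x :=
  Equiv.ofBijective_symm_apply_apply h hb x

/-! ### The Skula biframe and the unit -/

namespace FrithFrame

/-- A bijective frame homomorphism has a frame inverse; the second condition says that this inverse
respects the distinguished sublattices. -/
theorem isIso_iff {X Y : FrithFrame.{u}} (f : X ⟶ Y) :
    IsIso f ↔ Function.Bijective (Hom.toFrameHom f) ∧
      ∀ a, Hom.toFrameHom f a ∈ Y.lat → a ∈ X.lat := by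
  constructor
  · intro hf
    have h₁ : ∀ a, Hom.toFrameHom (inv f) (Hom.toFrameHom f a) = a := fun a => by
      rw [← comp_apply, IsIso.hom_inv_id]; rfl
    have h₂ : ∀ a, Hom.toFrameHom f (Hom.toFrameHom (inv f) a) = a := fun a => by
      rw [← comp_apply, IsIso.inv_hom_id]; rfl
    exact ⟨⟨Function.LeftInverse.injective h₁, Function.RightInverse.surjective h₂⟩,
      fun a ha => h₁ a ▸ Hom.map_lat (inv f) _ ha⟩
  · rintro ⟨hb, h⟩
    refine ⟨⟨(Hom.toFrameHom f).inverse hb, fun s hs => h _ ?_⟩, ?_, ?_⟩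
    · rwa [FrameHom.apply_inverse]
    · exact Hom.ext (DFunLike.ext _ _ (FrameHom.inverse_apply _ hb))
    · exact Hom.ext (DFunLike.ext _ _ (FrameHom.apply_inverse _ hb))

theorem nabla_mem (X : FrithFrame.{u}) (a : X.carrier) :
    FrameCon.nabla a ∈ FrameCon.relSub (X.lat : Set X.carrier) :=
  FrameCon.nabla_mem_relSub _ a

theorem delta_mem (X : FrithFrame.{u}) {s : X.carrier} (hs : s ∈ X.lat) :
    FrameCon.delta s ∈ FrameCon.relSub (X.lat : Set X.carrier) :=
  FrameCon.delta_mem_relSub hs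

/-- The closed congruence of `a` as an element of `𝒞_S L`. -/
def closed (X : FrithFrame.{u}) (a : X.carrier) : X.toBiframe.carrier :=
  ⟨FrameCon.nabla a, X.nabla_mem a⟩

/-- The open congruence of `s ∈ S` as an element of `𝒞_S L`. -/
def opened (X : FrithFrame.{u}) (s : X.lat) : X.toBiframe.carrier :=
  ⟨FrameCon.delta s.1, X.delta_mem s.2⟩

theorem mem_pos (X : FrithFrame.{u}) {θ : X.toBiframe.carrier} :
    θ ∈ X.toBiframe.pos ↔ ∃ a, X.closed a = θ :=
  Subframe.mem_within.trans (FrameCon.mem_nablaSub.trans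
    (exists_congr fun _ => ⟨fun h => Subtype.ext h, fun h => congrArg Subtype.val h⟩))

/-- The inclusion of `𝒞_S L` in the frame of all congruences. -/
def inclusion (X : FrithFrame.{u}) : FrameHom X.toBiframe.carrier (FrameCon X.carrier) :=
  Subframe.subtype _

theorem inclusion_injective (X : FrithFrame.{u}) : Function.Injective X.inclusion :=
  Subtype.val_injective

theorem mem_neg (X : FrithFrame.{u}) {θ : X.toBiframe.carrier} :
    θ ∈ X.toBiframe.neg ↔ ∃ P : Set X.lat, ⨆ s ∈ P, X.opened s = θ := by
  have hcoe : ∀ P : Set X.lat, X.inclusion (⨆ s ∈ P, X.opened s) =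
      ⨆ s ∈ Subtype.val '' P, FrameCon.delta s := fun P => by
    rw [iSup_image]
    simp only [map_iSup]
    rfl
  refine Subframe.mem_within.trans ((FrameCon.mem_deltaSub X.lat X.bot_mem).trans ?_)
  constructor
  · rintro ⟨P, hP, h⟩
    refine ⟨Subtype.val ⁻¹' P, X.inclusion_injective ((hcoe _).trans (Eq.trans ?_ h))⟩
    rw [Set.image_preimage_eq_of_subset (by simpa using hP)]
  · rintro ⟨P, rfl⟩
    exact ⟨Subtype.val '' P, by rintro _ ⟨s, _, rfl⟩; exact s.2, (hcoe P).symm⟩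

theorem isCompl_closed_opened (X : FrithFrame.{u}) (s : X.lat) :
    IsCompl (X.closed s.1) (X.opened s) :=
  Subframe.isCompl_coe.1 (FrameCon.isCompl_nabla_delta s.1)

theorem closed_mem_pos (X : FrithFrame.{u}) (a : X.carrier) : X.closed a ∈ X.toBiframe.pos :=
  X.mem_pos.2 ⟨a, rfl⟩

theorem opened_mem_neg (X : FrithFrame.{u}) (s : X.lat) : X.opened s ∈ X.toBiframe.neg :=
  X.mem_neg.2 ⟨{s}, by simp⟩

theorem isPosBicomplemented_closed (X : FrithFrame.{u}) {s : X.carrier} (hs : s ∈ X.lat) :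
    X.toBiframe.IsPosBicomplemented (X.closed s) :=
  ⟨X.closed_mem_pos s, _, X.opened_mem_neg ⟨s, hs⟩, X.isCompl_closed_opened ⟨s, hs⟩⟩

theorem isNegBicomplemented_opened (X : FrithFrame.{u}) (s : X.lat) :
    X.toBiframe.IsNegBicomplemented (X.opened s) :=
  ⟨X.opened_mem_neg s, _, X.closed_mem_pos s.1, (X.isCompl_closed_opened s).symm⟩

/-- The embedding of `L` in `𝒞_S L` by closed congruences. -/
def closedHom (X : FrithFrame.{u}) : FrameHom X.carrier X.toBiframe.carrier :=
  (FrameCon.nablaHom X.carrier).codRestrict _ X.nabla_mem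

theorem closedHom_apply (X : FrithFrame.{u}) (a : X.carrier) : X.closedHom a = X.closed a := rfl

theorem isZeroDimensional_toBiframe (X : FrithFrame.{u}) :
    Biframe.IsZeroDimensional X.toBiframe := by
  constructor
  · intro θ hθ
    obtain ⟨a, rfl⟩ := X.mem_pos.1 hθ
    obtain ⟨A, hA, rfl⟩ := X.joinDense a
    refine ⟨X.closedHom '' A, ?_, (map_sSup X.closedHom A).symm⟩
    rintro _ ⟨s, hs, rfl⟩
    exact X.isPosBicomplemented_closed (hA hs)
  · intro θ hθ
    obtain ⟨P, rfl⟩ := X.mem_neg.1 hθ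
    refine ⟨X.opened '' P, ?_, sSup_image⟩
    rintro _ ⟨s, _, rfl⟩
    exact X.isNegBicomplemented_opened s

/-- The only possible complement of `∇ₐ` is `Δₐ`, so the question is whether `Δₐ` lies in `ΔS`. -/
theorem isPosBicomplemented_closed_iff (X : FrithFrame.{u}) {a : X.carrier} :
    X.toBiframe.IsPosBicomplemented (X.closed a) ↔
      ∃ P ⊆ (X.lat : Set X.carrier), ⨆ s ∈ P, FrameCon.delta s = FrameCon.delta a := by
  rw [← FrameCon.mem_deltaSub X.lat X.bot_mem]
  constructor
  · rintro ⟨_, θ, hθ, hc⟩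
    rw [(FrameCon.isCompl_nabla_delta a).right_unique (Subframe.isCompl_coe.2 hc)]
    exact hθ
  · intro h
    exact ⟨X.closed_mem_pos a, ⟨FrameCon.delta a, FrameCon.deltaSub_le_relSub _ _ h⟩, h,
      Subframe.isCompl_coe.1 (FrameCon.isCompl_nabla_delta a)⟩

/-- An element witnessing strong exactness of a meet is that meet, so the elements `a` tested here
are exactly the strongly exact meets of subsets of `S`. -/
theorem isStronglyExact_iff (X : FrithFrame.{u}) : IsStronglyExact X ↔
    ∀ a, X.toBiframe.IsPosBicomplemented (X.closed a) → a ∈ X.lat := by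
  constructor
  · intro h a ha
    obtain ⟨P, hP, hPa⟩ := X.isPosBicomplemented_closed_iff.1 ha
    rw [FrameCon.eq_sInf_of_iSup_delta_eq hPa]
    exact h P hP ⟨a, hPa⟩
  · rintro h P hP ⟨a, ha⟩
    rw [← FrameCon.eq_sInf_of_iSup_delta_eq ha]
    exact h a (X.isPosBicomplemented_closed_iff.2 ⟨P, hP, ha⟩)

theorem closed_mem_bicompSub (X : FrithFrame.{u}) (a : X.carrier) :
    X.closed a ∈ X.toBiframe.bicompSub := by
  obtain ⟨A, hA, rfl⟩ := X.joinDense a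
  rw [← closedHom_apply, map_sSup]
  refine Subframe.sSup_mem _ ?_
  rintro _ ⟨s, hs, rfl⟩
  exact Subframe.subset_closure _ (X.isPosBicomplemented_closed (hA hs))

/-- The morphism `a ↦ ∇ₐ` from `(L, S)` to `𝔹₊(𝒞_S L, ∇L, ΔS)`. -/
def toBicomp (X : FrithFrame.{u}) : X ⟶ posBicompFunctor.obj (skulaFunctor.obj X) where
  toFrameHom := X.closedHom.codRestrict X.toBiframe.bicompSub X.closed_mem_bicompSub
  map_lat _ hs := X.isPosBicomplemented_closed hs

/-- Positive bicomplemented elements lie in the subframe `∇L`, so the subframe they generate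
contains only closed congruences. -/
theorem bijective_toBicomp (X : FrithFrame.{u}) :
    Function.Bijective (Hom.toFrameHom X.toBicomp) := by
  constructor
  · intro a b h
    exact FrameCon.nabla_injective (congrArg X.underlyingCon h)
  · intro θ
    obtain ⟨a, ha⟩ := X.mem_pos.1
      (Subframe.closure_le (T := X.toBiframe.pos) (fun _ h => h.1) θ.1 θ.2)
    exact ⟨a, Subtype.ext ha⟩

theorem isIso_toBicomp_iff (X : FrithFrame.{u}) : IsIso X.toBicomp ↔ IsStronglyExact X := by
  rw [isIso_iff, isStronglyExact_iff]
  exact and_iff_right X.bijective_toBicomp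

end FrithFrame

/-! ### Recognizing isomorphisms of biframes -/

namespace Biframe

/-- The image is a subframe containing both parts, hence everything. Lifting each part to the
corresponding part also makes the inverse a biframe morphism. -/
theorem isIso_of_injective {K L : Biframe.{u}} (f : K ⟶ L)
    (hf : Function.Injective (Hom.toFrameHom f))
    (hpos : ∀ y ∈ L.pos, ∃ x ∈ K.pos, Hom.toFrameHom f x = y)
    (hneg : ∀ y ∈ L.neg, ∃ x ∈ K.neg, Hom.toFrameHom f x = y) : IsIso f := by
  have hb : Function.Bijective (Hom.toFrameHom f) := by
    refine ⟨hf, fun y => ?_⟩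
    obtain ⟨A, hA, rfl⟩ := L.gen y
    refine Subframe.sSup_mem (Subframe.range (Hom.toFrameHom f)) fun y hy => ?_
    obtain ⟨F, hF, rfl⟩ := hA y hy
    refine Finset.inf_induction (p := (· ∈ Subframe.range (Hom.toFrameHom f)))
      (Subframe.top_mem _) (fun a ha b hb => Subframe.inf_mem _ ha hb) fun b hb => ?_
    rcases hF hb with hb | hb
    · obtain ⟨x, _, hx⟩ := hpos _ hb
      exact ⟨x, hx⟩
    · obtain ⟨x, _, hx⟩ := hneg _ hb
      exact ⟨x, hx⟩
  refine ⟨⟨(Hom.toFrameHom f).inverse hb, fun y hy => ?_, fun y hy => ?_⟩, ?_, ?_⟩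
  · obtain ⟨x, hx, rfl⟩ := hpos y hy
    rwa [FrameHom.inverse_apply]
  · obtain ⟨x, hx, rfl⟩ := hneg y hy
    rwa [FrameHom.inverse_apply]
  · exact Hom.ext (DFunLike.ext _ _ (FrameHom.inverse_apply _ hb))
  · exact Hom.ext (DFunLike.ext _ _ (FrameHom.apply_inverse _ hb))

end Biframe

/-! ### The adjunction -/

namespace FrithFrame

variable {X : FrithFrame.{u}} {K : Biframe.{u}}

theorem skula_hom_ext {f g : skulaFunctor.obj X ⟶ K}
    (h : ∀ a, Biframe.Hom.toFrameHom f (X.closed a) = Biframe.Hom.toFrameHom g (X.closed a)) :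
    f = g :=
  Biframe.Hom.ext (FrameCon.relSub_hom_ext h)

/-- The frame homomorphism to `K` underlying a morphism to `𝔹₊(K)`. -/
def toAmbient (f : X ⟶ posBicompFunctor.obj K) : FrameHom X.carrier K.carrier :=
  K.bicompSub.subtype.comp (Hom.toFrameHom f)

theorem isPosBicomplemented_toAmbient (f : X ⟶ posBicompFunctor.obj K) {s : X.carrier}
    (hs : s ∈ X.lat) : K.IsPosBicomplemented (toAmbient f s) := f.map_lat s hs

theorem exists_isCompl_toAmbient (f : X ⟶ posBicompFunctor.obj K) :
    ∀ s ∈ (X.lat : Set X.carrier), ∃ c, IsCompl (toAmbient f s) c := fun _ hs =>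
  let ⟨_, c, _, hc⟩ := isPosBicomplemented_toAmbient f hs
  ⟨c, hc⟩

theorem toAmbient_mem_pos (f : X ⟶ posBicompFunctor.obj K) (a : X.carrier) :
    toAmbient f a ∈ K.pos :=
  Subframe.closure_le (T := K.pos) (fun _ h => h.1) _ (Hom.toFrameHom f a).2

/-- The frame homomorphism from `𝒞_S L` to `K` corresponding to a morphism to `𝔹₊(K)`. -/
noncomputable def extendHom (f : X ⟶ posBicompFunctor.obj K) :
    FrameHom X.toBiframe.carrier K.carrier :=
  FrameCon.extend (toAmbient f) (exists_isCompl_toAmbient f)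

theorem extendHom_closed (f : X ⟶ posBicompFunctor.obj K) (a : X.carrier) :
    extendHom f (X.closed a) = toAmbient f a :=
  FrameCon.extend_nabla _ _ rfl

theorem extendHom_opened (f : X ⟶ posBicompFunctor.obj K) (s : X.lat) {c : K.carrier}
    (hc : IsCompl (toAmbient f s) c) : extendHom f (X.opened s) = c :=
  FrameCon.extend_delta _ _ rfl hc

/-- The biframe morphism corresponding to a morphism to `𝔹₊(K)`. -/
noncomputable def extend (f : X ⟶ posBicompFunctor.obj K) : Biframe.Hom X.toBiframe K where
  toFrameHom := extendHom f
  map_pos θ hθ := by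
    obtain ⟨a, rfl⟩ := X.mem_pos.1 hθ
    rw [extendHom_closed]
    exact toAmbient_mem_pos f a
  map_neg θ hθ := by
    obtain ⟨P, rfl⟩ := X.mem_neg.1 hθ
    rw [← sSup_image, map_sSup]
    refine Subframe.sSup_mem _ ?_
    rintro _ ⟨_, ⟨s, _, rfl⟩, rfl⟩
    -- The image of `Δₛ` is the complement of the image of `s`, and bicomplementation provides one
    -- in the negative part.
    obtain ⟨_, c, hc, hsc⟩ := isPosBicomplemented_toAmbient f s.2
    rwa [extendHom_opened f s hsc]

end FrithFrame

/-- The adjunction between the Skula functor and `𝔹₊`. -/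
noncomputable def skulaAdjunction : skulaFunctor.{u} ⊣ posBicompFunctor.{u} :=
  Adjunction.mkOfHomEquiv
    { homEquiv := fun X _ =>
        { toFun := fun g => X.toBicomp ≫ posBicompFunctor.map g
          invFun := FrithFrame.extend
          left_inv := fun g => FrithFrame.skula_hom_ext fun a =>
            FrithFrame.extendHom_closed (X.toBicomp ≫ posBicompFunctor.map g) a
          right_inv := fun f => FrithFrame.Hom.ext (DFunLike.ext _ _ fun a =>
            Subtype.ext (FrithFrame.extendHom_closed f a)) }
      homEquiv_naturality_left_symm := fun f g => FrithFrame.skula_hom_ext fun a =>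
        (FrithFrame.extendHom_closed (f ≫ g) a).trans
          ((FrithFrame.extendHom_closed g (FrithFrame.Hom.toFrameHom f a)).symm.trans
            (congrArg (FrithFrame.extendHom g)
              (Subtype.ext (FrameCon.map_nabla (FrithFrame.Hom.toFrameHom f) a).symm)))
      homEquiv_naturality_right := fun _ _ => rfl }

/-! ### The counit, and strong exactness of `𝔹₊(K)` -/

namespace Biframe

variable (K : Biframe.{u})

/-- The biframe morphism `𝒞_{𝔹₊(K)} ⟨𝔹₊(K)⟩ ⟶ K` that sends `∇ₐ` to `a` and `Δₛ` to the complement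
of `s`. -/
noncomputable def fromSkula : skulaFunctor.obj (posBicompFunctor.obj K) ⟶ K :=
  FrithFrame.extend (𝟙 (posBicompFunctor.obj K))

/-- The frame homomorphism underlying `fromSkula`. -/
noncomputable def fromSkulaHom : FrameHom K.toFrith.toBiframe.carrier K.carrier :=
  FrithFrame.extendHom (𝟙 (posBicompFunctor.obj K))

theorem fromSkulaHom_closed (a : K.toFrith.carrier) :
    K.fromSkulaHom (K.toFrith.closed a) = a.1 :=
  FrithFrame.extendHom_closed (𝟙 (posBicompFunctor.obj K)) a

theorem fromSkulaHom_opened (s : K.toFrith.lat) {c : K.carrier} (hc : IsCompl s.1.1 c) :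
    K.fromSkulaHom (K.toFrith.opened s) = c :=
  FrithFrame.extendHom_opened (𝟙 (posBicompFunctor.obj K)) s hc

/-- Biframe morphisms preserve positive bicomplemented elements, and the counit sends `∇ₐ` to `a`.
-/
theorem isStronglyExact_toFrith : FrithFrame.IsStronglyExact K.toFrith := by
  rw [FrithFrame.isStronglyExact_iff]
  intro a ha
  have h := Hom.map_isPosBicomplemented K.fromSkula ha
  have hK : K.fromSkulaHom (K.toFrith.closed a) = a.1 := K.fromSkulaHom_closed a
  show K.IsPosBicomplemented a.1
  exact hK ▸ h

end Biframe

/-! ### Compact zero-dimensional biframes -/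

namespace FrithFrame

theorem exists_sSup_eq (X : FrithFrame.{u}) (θ : X.toBiframe.carrier) :
    ∃ A ⊆ {φ | ∃ s t : X.lat, X.closed s ⊓ X.opened t = φ}, sSup A = θ := by
  obtain ⟨A, hA, h⟩ := FrameCon.exists_of_mem_relSub X.lat X.bot_mem X.top_mem X.joinDense θ.2
  refine ⟨X.inclusion ⁻¹' A, fun φ hφ => ?_, X.inclusion_injective ?_⟩
  · obtain ⟨s, hs, t, ht, h⟩ := hA hφ
    exact ⟨⟨s, hs⟩, ⟨t, ht⟩, X.inclusion_injective h⟩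
  · rw [map_sSup, Set.image_preimage_eq_of_subset]
    · exact h
    · intro φ hφ
      obtain ⟨s, hs, t, ht, rfl⟩ := hA hφ
      exact ⟨X.closed s ⊓ X.opened ⟨t, ht⟩, rfl⟩

theorem exists_isCompl_of_mem (X : FrithFrame.{u}) {φ : X.toBiframe.carrier}
    (h : ∃ s t : X.lat, X.closed s ⊓ X.opened t = φ) : ∃ γ, IsCompl φ γ := by
  obtain ⟨s, t, rfl⟩ := h
  exact ⟨_, (X.isCompl_closed_opened s).inf_sup (X.isCompl_closed_opened t).symm⟩

end FrithFrame

namespace Biframe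

variable {K : Biframe.{u}}

/-- It suffices to treat a basic `∇ₛ ∧ Δₜ`. Its image is `s ∧ c` with `c` the complement of `t`; if
this is `⊥` then `s ≤ t`, so `∇ₛ ∧ Δₜ ≤ ∇ₜ ∧ Δₜ = ⊥`. -/
theorem eq_bot_of_fromSkulaHom_eq_bot {θ : K.toFrith.toBiframe.carrier}
    (h : K.fromSkulaHom θ = ⊥) : θ = ⊥ := by
  obtain ⟨A, hA, rfl⟩ := K.toFrith.exists_sSup_eq θ
  refine sSup_eq_bot.2 fun φ hφ => ?_
  have hφ' : K.fromSkulaHom φ = ⊥ := le_bot_iff.1 (h ▸ OrderHomClass.mono _ (le_sSup hφ))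
  obtain ⟨s, t, rfl⟩ := hA hφ
  obtain ⟨_, c, _, hc⟩ := t.2
  rw [map_inf, fromSkulaHom_closed, K.fromSkulaHom_opened t hc, ← disjoint_iff,
    hc.disjoint_right_iff] at hφ'
  rw [← le_bot_iff, ← (K.toFrith.isCompl_closed_opened t).inf_eq_bot]
  exact inf_le_inf_right _ (OrderHomClass.mono K.toFrith.closedHom hφ')

/-- By compactness a finite join of basic elements below `θ` already maps to `⊤`. That join is
complemented, its complement maps to `⊥` and so is `⊥`; hence the join is `⊤`. -/
theorem eq_top_of_fromSkulaHom_eq_top (hK : K.IsCompactBiframe)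
    {θ : K.toFrith.toBiframe.carrier} (h : K.fromSkulaHom θ = ⊤) : θ = ⊤ := by
  obtain ⟨A, hA, rfl⟩ := K.toFrith.exists_sSup_eq θ
  rw [map_sSup, sSup_image'] at h
  obtain ⟨F, hF⟩ := CompleteLattice.IsCompactElement.exists_finset_of_le_iSup _ hK
    (fun φ : A => K.fromSkulaHom φ) h.ge
  have hc : IsComplemented (F.sup fun φ : A => φ.1) :=
    Finset.sup_induction isComplemented_bot (fun _ ha _ hb => ha.sup hb)
      fun φ _ => K.toFrith.exists_isCompl_of_mem (hA φ.2)
  obtain ⟨γ, hγ⟩ := hc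
  have htop : K.fromSkulaHom (F.sup fun φ : A => φ.1) = ⊤ := by
    rw [map_finset_sup, Finset.sup_eq_iSup]
    exact top_le_iff.1 hF
  have hbot : γ = ⊥ := eq_bot_of_fromSkulaHom_eq_bot (by
    simpa [htop] using (hγ.map K.fromSkulaHom).inf_eq_bot)
  refine top_le_iff.1 (le_trans ?_ (Finset.sup_le fun φ _ => le_sSup φ.2 :
    (F.sup fun φ : A => φ.1) ≤ sSup A))
  rw [← hγ.sup_eq_top, hbot, sup_bot_eq]

/-- For `ψ` with complement `γ`, `ψ ≤ φ` means `γ ∨ φ = ⊤`, which the map reflects. Complemented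
elements form a join-basis, so the whole order is reflected. -/
theorem fromSkulaHom_injective (hK : K.IsCompactBiframe) :
    Function.Injective K.fromSkulaHom := by
  have key : ∀ θ φ, K.fromSkulaHom θ ≤ K.fromSkulaHom φ → θ ≤ φ := by
    intro θ φ h
    obtain ⟨A, hA, rfl⟩ := K.toFrith.exists_sSup_eq θ
    refine sSup_le fun ψ hψ => ?_
    obtain ⟨γ, hγ⟩ := K.toFrith.exists_isCompl_of_mem (hA hψ)
    rw [hγ.left_le_iff, codisjoint_iff]
    refine eq_top_of_fromSkulaHom_eq_top hK ?_
    rw [map_sup, ← codisjoint_iff, ← (hγ.map K.fromSkulaHom).left_le_iff]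
    exact (OrderHomClass.mono K.fromSkulaHom (le_sSup hψ)).trans h
  exact fun θ φ h => le_antisymm (key _ _ h.le) (key _ _ h.ge)

theorem isIso_fromSkula (hK : K.IsCompactBiframe) (hZ : IsZeroDimensional K) :
    IsIso K.fromSkula := by
  refine isIso_of_injective _ (fromSkulaHom_injective hK) (fun y hy => ?_) fun y hy => ?_
  · have hy' : y ∈ K.bicompSub := by
      obtain ⟨A, hA, rfl⟩ := hZ.1 y hy
      exact Subframe.sSup_mem _ fun a ha => Subframe.subset_closure _ (hA a ha)
    exact ⟨_, K.toFrith.closed_mem_pos ⟨y, hy'⟩, K.fromSkulaHom_closed ⟨y, hy'⟩⟩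
  · obtain ⟨A, hA, rfl⟩ := hZ.2 y hy
    -- Each `c ∈ A` is the image of `Δₛ` for its complement `s`, so the join of these `Δₛ` maps to
    -- `⋁ A`.
    let P : Set K.toFrith.lat := {s | ∃ c ∈ A, IsCompl s.1.1 c}
    refine ⟨⨆ s ∈ P, K.toFrith.opened s, K.toFrith.mem_neg.2 ⟨P, rfl⟩, ?_⟩
    refine (map_iSup₂ K.fromSkulaHom fun s (_ : s ∈ P) => K.toFrith.opened s).trans
      (le_antisymm (iSup₂_le ?_) (sSup_le fun c hc => ?_))
    · rintro s ⟨c, hc, hsc⟩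
      rw [K.fromSkulaHom_opened s hsc]
      exact le_sSup hc
    · obtain ⟨hneg, s, hs, hcs⟩ := hA c hc
      have hs' : K.IsPosBicomplemented s := ⟨hs, c, hneg, hcs.symm⟩
      let s' : K.toFrith.lat := ⟨⟨s, Subframe.subset_closure _ hs'⟩, hs'⟩
      rw [← K.fromSkulaHom_opened s' hcs.symm]
      exact le_iSup₂ (f := fun s (_ : s ∈ P) => K.fromSkulaHom (K.toFrith.opened s)) s'
        ⟨c, hc, hcs.symm⟩

end Biframe

/-! ### Restriction to the full subcategories -/

/-- The restriction of `skulaFunctor` to strongly exact Frith frames and zero-dimensional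
biframes. -/
abbrev skulaRestricted : FrithFrame.IsStronglyExact.{u}.FullSubcategory ⥤
    Biframe.IsZeroDimensional.{u}.FullSubcategory :=
  Biframe.IsZeroDimensional.lift (FrithFrame.IsStronglyExact.ι ⋙ skulaFunctor.{u})
    fun X => X.obj.isZeroDimensional_toBiframe

/-- The restriction of `posBicompFunctor` to zero-dimensional biframes and strongly exact Frith
frames. -/
abbrev posBicompRestricted : Biframe.IsZeroDimensional.{u}.FullSubcategory ⥤
    FrithFrame.IsStronglyExact.{u}.FullSubcategory :=
  FrithFrame.IsStronglyExact.lift (Biframe.IsZeroDimensional.ι ⋙ posBicompFunctor.{u})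
    fun K => K.obj.isStronglyExact_toFrith

/-- The restriction of `skulaAdjunction` to the full subcategories. -/
noncomputable def skulaAdjunctionRestricted : skulaRestricted.{u} ⊣ posBicompRestricted.{u} :=
  skulaAdjunction.restrictFullyFaithful FrithFrame.IsStronglyExact.fullyFaithfulι
    Biframe.IsZeroDimensional.fullyFaithfulι (Iso.refl _) (Iso.refl _)

/-- The fully faithful inclusion reflects isomorphisms and takes the restricted unit to the original
one, up to identity comparison maps. -/
instance isIso_skulaAdjunctionRestricted_unit_app
    (X : FrithFrame.IsStronglyExact.{u}.FullSubcategory) :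
    IsIso (skulaAdjunctionRestricted.unit.app X) := by
  have : IsIso (skulaAdjunction.unit.app (FrithFrame.IsStronglyExact.ι.obj X)) :=
    X.obj.isIso_toBicomp_iff.2 X.property
  have : IsIso (FrithFrame.IsStronglyExact.ι.map (skulaAdjunctionRestricted.unit.app X)) := by
    rw [skulaAdjunctionRestricted, Adjunction.map_restrictFullyFaithful_unit_app]
    infer_instance
  exact isIso_of_fully_faithful FrithFrame.IsStronglyExact.ι _

/-- Strongly exact Frith frames form a full coreflective subcategory of the zero-dimensional
biframes. -/
noncomputable instance coreflectiveSkulaRestricted : Coreflective skulaRestricted.{u} :=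
  -- A left adjoint with invertible unit is fully faithful.
  have := NatIso.isIso_of_isIso_app skulaAdjunctionRestricted.{u}.unit
  { skulaAdjunctionRestricted.{u}.fullyFaithfulLOfIsIsoUnit.full,
    skulaAdjunctionRestricted.{u}.fullyFaithfulLOfIsIsoUnit.faithful with
    R := posBicompRestricted
    adj := skulaAdjunctionRestricted }

theorem mainTheorem4 :
    ∃ adj : skulaFunctor.{u} ⊣ posBicompFunctor.{u},
      -- the unit at `(L, S)` is `a ↦ ∇ₐ`
      (∀ (X : FrithFrame.{u}) (a : X.carrier),
        X.underlyingCon (FrithFrame.Hom.toFrameHom (adj.unit.app X) a) = FrameCon.nabla a) ∧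
      adj.IsIdempotentAdjunction ∧
      -- fixpoints among Frith frames
      (∀ X : FrithFrame.{u}, IsIso (adj.unit.app X) ↔ FrithFrame.IsStronglyExact X) ∧
      -- compact zero-dimensional biframes are fixpoints
      (∀ K : Biframe.{u}, K.IsCompactBiframe → Biframe.IsZeroDimensional K →
        IsIso (adj.counit.app K)) ∧
      -- the functors restrict, and exhibit the strongly exact Frith frames as a full coreflective
      -- subcategory of the zero-dimensional biframes
      ∃ (hZ : ∀ X : FrithFrame.{u},
            Biframe.IsZeroDimensional.{u} (skulaFunctor.obj X))
        (hS : ∀ K : Biframe.{u},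
            FrithFrame.IsStronglyExact.{u} (posBicompFunctor.obj K))
        (_ : Coreflective (Biframe.IsZeroDimensional.lift
          (FrithFrame.IsStronglyExact.ι ⋙ skulaFunctor.{u}) fun X => hZ X.obj)),
        Nonempty (coreflector (Biframe.IsZeroDimensional.lift
            (FrithFrame.IsStronglyExact.ι ⋙ skulaFunctor.{u}) fun X => hZ X.obj) ≅
          FrithFrame.IsStronglyExact.lift
            (Biframe.IsZeroDimensional.ι ⋙ posBicompFunctor.{u}) fun K => hS K.obj) := by
  have hunit : ∀ X : FrithFrame.{u},
      IsIso (skulaAdjunction.unit.app X) ↔ FrithFrame.IsStronglyExact X :=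
    fun X => X.isIso_toBicomp_iff
  have hS : ∀ K : Biframe.{u}, IsIso (skulaAdjunction.unit.app (posBicompFunctor.obj K)) :=
    fun K => (hunit _).2 K.isStronglyExact_toFrith
  -- The final `Iso.refl` suffices because the coreflector chosen in `coreflectiveSkulaRestricted`
  -- is the restricted `𝔹₊` itself.
  exact ⟨skulaAdjunction, fun _ _ => rfl, ⟨skulaAdjunction.isIso_counit_app_obj hS, hS⟩, hunit,
    fun _ hK hZ => Biframe.isIso_fromSkula hK hZ, fun X => X.isZeroDimensional_toBiframe,
    fun K => K.isStronglyExact_toFrith, coreflectiveSkulaRestricted, ⟨Iso.refl _⟩⟩
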